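/- Consider $n$ agents and $n$ objects, each agent having a strict preference order over the objects; two agents are of the same type if their orders are identical. A random assignment is a doubly stochastic $n\times n$ matrix $p=(p(i)(o))$; a deterministic assignment is a permutation matrix; it is Pareto optimal if no other deterministic assignment is weakly better for all agents and strictly better for some agent. A random assignment $p$ is robust ex post efficient if in every decomposition $p=\sum_{j}\lambda_jP_j$ with $\lambda_j\in(0,1]$, $\sum_j\lambda_j=1$ and permutation matrices $P_j$, all $P_j$ are Pareto optimal. A trading cycle consistent with $p$ is a cycle $o_0\to a_0\to o_1\to a_1\to\dots\to o_{m}\to a_{m}\to o_0$ of distinct objects $o_j$ and distinct agents $a_j$ such that $p(a_j)(o_j)>0$ and $a_j$ strictly prefers $o_{j+1}$ to $o_j$ for all $j$ (indices modulo $m+1$); it is short if it contains at most one agent of each type. Theorem. Let $k$ be a constant. (1) Restricted to instances with at most $k$ agent types, the problem of deciding, given the preference lists and a random assignment $p$ with rational entries (numerators and denominators in binary), whether $p$ is robust ex post efficient, is solvable in polynomial time: there are an algorithm (a random access machine program with addition and subtraction, each instruction counting as one step) and a polynomial, both depending only on $k$, such that on every such instance the algorithm halts with the correct answer within a number of steps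 bounded by the polynomial in the binary length of the input. (2) For all preferences and every random assignment $p$, $p$ is robust ex post efficient if and only if there is no short trading cycle consistent with $p$ such that the agents outside the cycle can be perfectly matched to the objects outside the cycle along pairs $(i,o)$ with $p(i)(o)>0$. (3) If there are at most $k$ agent types, the number of short trading cycles consistent with $p$ is $O(n^{2k})$, with a constant depending only on $k$. -/

import Mathlib

/-!  ## The assignment setting

There are `n` agents and `n` objects, both indexed by `Fin n`. A strict preference of an agent is
the list of all objects from best to worst, that is, a permutation of `Fin n` sending a position
(`0` is the best one) to the object in that position. -/

/-- A profile of strict preferences: `pref i r` is the object in position `r` of the list of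
agent `i` (position `0` is the most preferred one). -/
abbrev Profile (n : ℕ) : Type := Fin n → Equiv.Perm (Fin n)

namespace Profile

variable {n : ℕ}

/-- Agent `i` strictly prefers object `a` to object `b`. -/
def Strict (pref : Profile n) (i a b : Fin n) : Prop :=
  (pref i).symm a < (pref i).symm b

/-- Agent `i` values object `a` at least as much as object `b`. -/
def Weak (pref : Profile n) (i a b : Fin n) : Prop :=
  ¬ pref.Strict i b a

/-- The number of agent types, two agents being of the same type if their preferences are
identical: the number of distinct preferences in the profile. -/
def numTypes (pref : Profile n) : ℕ :=
  (Finset.univ.image pref).card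

/-- A deterministic assignment is a permutation `d` (agent `i` receives object `d i`). It is Pareto
optimal if no deterministic assignment is weakly better for all agents and strictly better for
some agent. -/
def ParetoOptimal (pref : Profile n) (d : Equiv.Perm (Fin n)) : Prop :=
  ¬ ∃ e : Equiv.Perm (Fin n),
    (∀ i, pref.Weak i (e i) (d i)) ∧ ∃ i, pref.Strict i (e i) (d i)

end Profile

/-- A decomposition of a matrix `p` into permutation matrices: `p = ∑ j, weight j • P j` where
the weights lie in `(0, 1]` and sum to `1`, and `P j` is the matrix of the deterministic
assignment `assign j` (a `1` in row `i` and column `assign j i`). -/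
structure Decomposition {n : ℕ} (p : Matrix (Fin n) (Fin n) ℝ) where
  /-- the number of summands -/
  len : ℕ
  /-- the weights -/
  weight : Fin len → ℝ
  /-- the deterministic assignments -/
  assign : Fin len → Equiv.Perm (Fin n)
  weight_pos : ∀ j, 0 < weight j
  weight_le_one : ∀ j, weight j ≤ 1
  weight_sum : ∑ j, weight j = 1
  eq_sum : p = ∑ j, weight j • (assign j).permMatrix ℝ

/-- A random assignment is robust ex post efficient if every decomposition of it consists of
Pareto optimal deterministic assignments. -/
def RobustExPostEfficient {n : ℕ} (pref : Profile n) (p : Matrix (Fin n) (Fin n) ℝ) : Prop :=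
  ∀ D : Decomposition p, ∀ j, pref.ParetoOptimal (D.assign j)

/-- A trading cycle consistent with `p`:
`object 0 → agent 0 → object 1 → agent 1 → ⋯ → object len → agent len → object 0`,
where an object can point to an agent who receives it with positive probability, and an agent
points to an object strictly preferred to the one pointing to him. The addition in `Fin (len + 1)`
is cyclic. -/
structure TradingCycle {n : ℕ} (pref : Profile n) (p : Matrix (Fin n) (Fin n) ℝ) where
  /-- the number of agents in the cycle, minus one -/
  len : ℕ
  /-- the agents of the cycle -/
  agent : Fin (len + 1) → Fin n
  /-- the objects of the cycle -/
  object : Fin (len + 1) → Fin n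
  agent_injective : Function.Injective agent
  object_injective : Function.Injective object
  consistent : ∀ j, 0 < p (agent j) (object j)
  improves : ∀ j, pref.Strict (agent j) (object (j + 1)) (object j)

namespace TradingCycle

variable {n : ℕ} {pref : Profile n} {p : Matrix (Fin n) (Fin n) ℝ}

/-- A trading cycle is short if it contains at most one agent of each type. -/
def Short (c : TradingCycle pref p) : Prop :=
  ∀ j l, pref (c.agent j) = pref (c.agent l) → j = l

/-- The agents outside the cycle can be perfectly matched to the objects outside the cycle within
the support of `p`. -/
def RestMatchable (c : TradingCycle pref p) : Prop :=
  ∃ m : {i : Fin n // i ∉ Set.range c.agent} ≃ {o : Fin n // o ∉ Set.range c.object},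
    ∀ i, 0 < p i.1 (m i).1

end TradingCycle

/-! ## Random access machines

Programs of a random access machine with natural-number registers and a memory of natural numbers
with indirect addressing, in structured form. The arithmetic is addition and truncated
subtraction (there is no multiplication), so that `t` steps produce numbers at most `t` bits
longer than the numbers at the start, and polynomial time under the unit cost measure used here is
polynomial time on Turing machines. -/

/-- Programs. Registers are numbered by natural numbers. -/
inductive RAMProgram : Type
  /-- do nothing -/
  | skip : RAMProgram
  /-- `x := c` for a constant `c` -/
  | const (x c : ℕ) : RAMProgram
  /-- `x := y` -/
  | copy (x y : ℕ) : RAMProgram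
  /-- `x := y + z` -/
  | add (x y z : ℕ) : RAMProgram
  /-- `x := max (y - z) 0` -/
  | sub (x y z : ℕ) : RAMProgram
  /-- `x := memory[y]` -/
  | load (x y : ℕ) : RAMProgram
  /-- `memory[x] := y` -/
  | store (x y : ℕ) : RAMProgram
  /-- first `c`, then `d` -/
  | seq (c d : RAMProgram) : RAMProgram
  /-- `c` if register `x` is nonzero, and `d` if it is zero -/
  | cond (x : ℕ) (c d : RAMProgram) : RAMProgram
  /-- repeat `c` as long as register `x` is nonzero -/
  | loop (x : ℕ) (c : RAMProgram) : RAMProgram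

/-- The contents of the registers and of the memory. -/
structure RAMState where
  /-- the registers -/
  reg : ℕ → ℕ
  /-- the memory -/
  mem : ℕ → ℕ

namespace RAMState

/-- Write the value `v` to register `x`. -/
def setReg (s : RAMState) (x v : ℕ) : RAMState :=
  { s with reg := Function.update s.reg x v }

/-- Write the value `v` to the memory cell with address `a`. -/
def setMem (s : RAMState) (a v : ℕ) : RAMState :=
  { s with mem := Function.update s.mem a v }

/-- The initial state: the input in the memory from address `0` on, its length in register `0`,
and `0` everywhere else. -/
def init (input : List ℕ) : RAMState where
  reg := fun x => if x = 0 then input.length else 0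
  mem := fun a => input.getD a 0

end RAMState

/-- `Exec c s s' t`: started in the state `s`, the program `c` halts in the state `s'` after exactly
`t` steps. Each elementary instruction and each test of a register is one step. -/
inductive Exec : RAMProgram → RAMState → RAMState → ℕ → Prop
  | skip (s : RAMState) : Exec .skip s s 1
  | const (s : RAMState) (x c : ℕ) : Exec (.const x c) s (s.setReg x c) 1
  | copy (s : RAMState) (x y : ℕ) : Exec (.copy x y) s (s.setReg x (s.reg y)) 1
  | add (s : RAMState) (x y z : ℕ) :
      Exec (.add x y z) s (s.setReg x (s.reg y + s.reg z)) 1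
  | sub (s : RAMState) (x y z : ℕ) :
      Exec (.sub x y z) s (s.setReg x (s.reg y - s.reg z)) 1
  | load (s : RAMState) (x y : ℕ) : Exec (.load x y) s (s.setReg x (s.mem (s.reg y))) 1
  | store (s : RAMState) (x y : ℕ) : Exec (.store x y) s (s.setMem (s.reg x) (s.reg y)) 1
  | seq {c d : RAMProgram} {s s₁ s₂ : RAMState} {t₁ t₂ : ℕ} :
      Exec c s s₁ t₁ → Exec d s₁ s₂ t₂ → Exec (.seq c d) s s₂ (t₁ + t₂)
  | cond_nonzero {x : ℕ} {c d : RAMProgram} {s s₁ : RAMState} {t : ℕ} :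
      s.reg x ≠ 0 → Exec c s s₁ t → Exec (.cond x c d) s s₁ (t + 1)
  | cond_zero {x : ℕ} {c d : RAMProgram} {s s₁ : RAMState} {t : ℕ} :
      s.reg x = 0 → Exec d s s₁ t → Exec (.cond x c d) s s₁ (t + 1)
  | loop_nonzero {x : ℕ} {c : RAMProgram} {s s₁ s₂ : RAMState} {t₁ t₂ : ℕ} :
      s.reg x ≠ 0 → Exec c s s₁ t₁ → Exec (.loop x c) s₁ s₂ t₂ →
      Exec (.loop x c) s s₂ (t₁ + t₂ + 1)
  | loop_zero {x : ℕ} {c : RAMProgram} {s : RAMState} :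
      s.reg x = 0 → Exec (.loop x c) s s 1

/-- The size of an input: its total length in binary notation, with one separator per number. -/
def inputSize (input : List ℕ) : ℕ :=
  (input.map fun x => x.size + 1).sum

/-- The property `P` of the objects in `α`, given to a machine through the encoding `enc`, is
decidable in polynomial time: one program halts on all inputs within a number of steps that is
polynomial in the input size, leaving `1` in register `0` if `P` holds, and `0` otherwise. -/
def DecidableInPolyTime {α : Type} (enc : α → List ℕ) (P : α → Prop) : Prop :=
  ∃ (c : RAMProgram) (q : Polynomial ℕ), ∀ a : α, ∃ (s : RAMState) (t : ℕ),
    Exec c (RAMState.init (enc a)) s t ∧ t ≤ q.eval (inputSize (enc a)) ∧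
      (P a → s.reg 0 = 1) ∧ (¬ P a → s.reg 0 = 0)

/-! ## The decision problem -/

/-- An instance of the problem: a profile of strict preferences and a random assignment with
rational entries, that is, a doubly stochastic matrix. -/
structure AssignmentInstance : Type where
  /-- the number of agents, and of objects -/
  n : ℕ
  /-- the preferences -/
  pref : Profile n
  /-- the random assignment -/
  p : Matrix (Fin n) (Fin n) ℚ
  p_mem : p ∈ doublyStochastic ℚ (Fin n)

namespace AssignmentInstance

/-- The matrix of the random assignment, as a real matrix. -/
def realMatrix (I : AssignmentInstance) : Matrix (Fin I.n) (Fin I.n) ℝ :=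
  I.p.map fun x : ℚ => (x : ℝ)

/-- The input of the machine: the number `n`, then the preference lists of the agents (each from
best to worst), then the rows of the matrix, each entry given by its numerator and its
denominator. -/
def encode (I : AssignmentInstance) : List ℕ :=
  I.n ::
    ((List.finRange I.n).flatMap fun i => (List.finRange I.n).map fun r => (I.pref i r : ℕ)) ++
    ((List.finRange I.n).flatMap fun i => (List.finRange I.n).flatMap fun o =>
      [(I.p i o).num.natAbs, (I.p i o).den])

end AssignmentInstance

/-! ## A loop language compiled to random access machines -/

namespace RAMState

/-! Robustness depends only on the support of `p`. Permutations in a decomposition lie in the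
support. Conversely, a permutation `d` in the support can be subtracted with a small weight, and
Birkhoff's theorem applied to the rescaled remainder puts `d` into a decomposition. So robustness
fails exactly if some permutation in the support is not Pareto optimal
(`not_robustExPostEfficient_iff`).

A permutation `d` fails to be Pareto optimal exactly if its envy graph has a cycle. If a cycle
contains two agents of one type, the one with the worse object envies everybody the other envies, so
the cycle can be cut; a shortest closed walk therefore has at most one agent of each type
(`Profile.not_paretoOptimal_iff`). Splitting `d` into its part on such a cycle and its part outside
gives the criterion by short trading cycles. A short cycle has at most `k` agents, so it is coded by
its length and `k` pairs of agents and objects, whence the bound `k * n ^ (2 * k)`.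

For the algorithm it is convenient to have a single length: a cycle of length at most `k`, traversed
repeatedly, is a closed walk of length `k !`, and conversely every closed envy walk contains a short
cycle. The program enumerates all choices of `K = k !` agents and `K` objects with `2 * K` nested
loops, tests that they form a closed walk of improvements, and looks for a perfect matching in the
support that contains all these pairs. The matching is found by an auction: an unmatched agent takes
a cheapest acceptable object and raises its price by one. A holder is then always within one unit of
his cheapest acceptable object, which keeps all prices at most `n` if a perfect matching exists
(`AuctionInv.price_lt`), so a bounded number of rounds suffices (`auction_spec`).

Programs are written in a small language whose loops all run over the numbers below `n`. Its
compiler comes with a polynomial step bound (`LoopStmt.runs_compile`), so only the effect on the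
memory remains to be verified. -/

@[simp] theorem setReg_reg (s : RAMState) (x v r : ℕ) :
    (s.setReg x v).reg r = if r = x then v else s.reg r := by
  simp [setReg, Function.update_apply]

@[simp] theorem setReg_mem (s : RAMState) (x v : ℕ) : (s.setReg x v).mem = s.mem := rfl

@[simp] theorem setMem_reg (s : RAMState) (a v : ℕ) : (s.setMem a v).reg = s.reg := rfl

@[simp] theorem setMem_mem (s : RAMState) (a v : ℕ) :
    (s.setMem a v).mem = Function.update s.mem a v := rfl

end RAMState

/-- The program `c` started in `s` halts after at most `T` steps in a state satisfying `Q`. -/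
def Runs (c : RAMProgram) (s : RAMState) (T : ℕ) (Q : RAMState → Prop) : Prop :=
  ∃ s' t, Exec c s s' t ∧ t ≤ T ∧ Q s'

/-! ### Rules for step-bounded correctness of machine programs. -/

namespace Runs

variable {s : RAMState} {Q Q' : RAMState → Prop} {T T' : ℕ} {c d : RAMProgram}

theorem mono (h : Runs c s T Q) (hT : T ≤ T') (hQ : ∀ s', Q s' → Q' s') : Runs c s T' Q' := by
  obtain ⟨s', t, h1, h2, h3⟩ := h
  exact ⟨s', t, h1, h2.trans hT, hQ _ h3⟩

theorem skip (h : Q s) : Runs .skip s 1 Q := ⟨_, _, .skip s, le_rfl, h⟩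

theorem const {x a : ℕ} (h : Q (s.setReg x a)) : Runs (.const x a) s 1 Q :=
  ⟨_, _, .const s x a, le_rfl, h⟩

theorem copy {x y : ℕ} (h : Q (s.setReg x (s.reg y))) : Runs (.copy x y) s 1 Q :=
  ⟨_, _, .copy s x y, le_rfl, h⟩

theorem add {x y z : ℕ} (h : Q (s.setReg x (s.reg y + s.reg z))) : Runs (.add x y z) s 1 Q :=
  ⟨_, _, .add s x y z, le_rfl, h⟩

theorem sub {x y z : ℕ} (h : Q (s.setReg x (s.reg y - s.reg z))) : Runs (.sub x y z) s 1 Q :=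
  ⟨_, _, .sub s x y z, le_rfl, h⟩

theorem load {x y : ℕ} (h : Q (s.setReg x (s.mem (s.reg y)))) : Runs (.load x y) s 1 Q :=
  ⟨_, _, .load s x y, le_rfl, h⟩

theorem store {x y : ℕ} (h : Q (s.setMem (s.reg x) (s.reg y))) : Runs (.store x y) s 1 Q :=
  ⟨_, _, .store s x y, le_rfl, h⟩

theorem seq (h : Runs c s T Q) (h' : ∀ s', Q s' → Runs d s' T' Q') :
    Runs (.seq c d) s (T + T') Q' := by
  obtain ⟨s₁, t₁, h1, h2, h3⟩ := h
  obtain ⟨s₂, t₂, k1, k2, k3⟩ := h' _ h3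
  exact ⟨s₂, _, .seq h1 k1, by omega, k3⟩

theorem cond {x : ℕ} (h : s.reg x ≠ 0 → Runs c s T Q) (h' : s.reg x = 0 → Runs d s T Q) :
    Runs (.cond x c d) s (T + 1) Q := by
  by_cases hx : s.reg x = 0
  · obtain ⟨s', t, h1, h2, h3⟩ := h' hx
    exact ⟨s', _, .cond_zero hx h1, by omega, h3⟩
  · obtain ⟨s', t, h1, h2, h3⟩ := h hx
    exact ⟨s', _, .cond_nonzero hx h1, by omega, h3⟩

/-- A loop whose register counts down, with the invariant `I j` if `j` rounds remain. -/
theorem loop {x : ℕ} (I : ℕ → RAMState → Prop) (hreg : ∀ j s, I j s → s.reg x = j)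
    (hbody : ∀ j s, I (j + 1) s → Runs c s T (I j)) :
    ∀ j s, I j s → Runs (.loop x c) s (j * (T + 1) + 1) (I 0) := by
  intro j
  induction j with
  | zero => exact fun s hs => ⟨s, 1, .loop_zero (hreg _ _ hs), by omega, hs⟩
  | succ j ih =>
    intro s hs
    obtain ⟨s₁, t₁, h1, h2, h3⟩ := hbody j s hs
    obtain ⟨s₂, t₂, k1, k2, k3⟩ := ih s₁ h3
    refine ⟨s₂, _, .loop_nonzero (by rw [hreg _ _ hs]; omega) h1 k1, ?_, k3⟩
    linarith [add_mul j 1 (T + 1)]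

end Runs

/-- Apply `f 0`, then `f 1`, and so on up to `f (m - 1)`. -/
def foldRange {α : Type*} (f : ℕ → α → α) : ℕ → α → α
  | 0, a => a
  | m + 1, a => f m (foldRange f m a)

/-- Expressions over natural-number variables and a memory, with sums over the numbers below a
size parameter. -/
inductive LoopExpr : Type
  | var (x : ℕ) : LoopExpr
  | size : LoopExpr
  | const (c : ℕ) : LoopExpr
  | add (a b : LoopExpr) : LoopExpr
  | sub (a b : LoopExpr) : LoopExpr
  | load (a : LoopExpr) : LoopExpr
  | sum (x : ℕ) (e : LoopExpr) : LoopExpr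

namespace LoopExpr

/-- The value of an expression. -/
def eval (N : ℕ) (mem : ℕ → ℕ) : LoopExpr → (ℕ → ℕ) → ℕ
  | var x, env => env x
  | size, _ => N
  | const c, _ => c
  | add a b, env => a.eval N mem env + b.eval N mem env
  | sub a b, env => a.eval N mem env - b.eval N mem env
  | load a, env => mem (a.eval N mem env)
  | sum x e, env => ∑ v ∈ Finset.range N, e.eval N mem (Function.update env x v)

/-- The program that computes an expression into the scratch register `2 * d + 3`, using only the
scratch registers from there on. Register `1` holds the size, and register `2 * x + 2` holds the
variable `x`. -/
def compile : LoopExpr → ℕ → RAMProgram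
  | var x, d => .copy (2 * d + 3) (2 * x + 2)
  | size, d => .copy (2 * d + 3) 1
  | const c, d => .const (2 * d + 3) c
  | add a b, d => .seq (a.compile d) (.seq (b.compile (d + 1))
      (.add (2 * d + 3) (2 * d + 3) (2 * d + 5)))
  | sub a b, d => .seq (a.compile d) (.seq (b.compile (d + 1))
      (.sub (2 * d + 3) (2 * d + 3) (2 * d + 5)))
  | load a, d => .seq (a.compile d) (.load (2 * d + 3) (2 * d + 3))
  | sum x e, d =>
      -- Register `2 * d + 3` accumulates, `2 * d + 5` counts down, and `2 * d + 7` saves the old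
      -- value of the variable. The summand appears in `2 * d + 9`, which afterwards serves for the
      -- constant `1`.
      .seq (.const (2 * d + 3) 0) <| .seq (.copy (2 * d + 5) 1) <|
      .seq (.copy (2 * d + 7) (2 * x + 2)) <| .seq (.const (2 * x + 2) 0) <|
      .seq (.loop (2 * d + 5) <| .seq (e.compile (d + 3)) <|
        .seq (.add (2 * d + 3) (2 * d + 3) (2 * d + 9)) <| .seq (.const (2 * d + 9) 1) <|
        .seq (.add (2 * x + 2) (2 * x + 2) (2 * d + 9))
          (.sub (2 * d + 5) (2 * d + 5) (2 * d + 9)))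
      (.copy (2 * x + 2) (2 * d + 7))

/-- A bound on the number of steps, as a polynomial in the size. -/
noncomputable def cost : LoopExpr → Polynomial ℕ
  | var _ => 1
  | size => 1
  | const _ => 1
  | add a b => a.cost + (b.cost + 1)
  | sub a b => a.cost + (b.cost + 1)
  | load a => a.cost + 1
  | sum _ e => 6 + Polynomial.X * (e.cost + 5)

/-- The last clause is the frame condition that makes the induction work: variables, the size and
lower scratch registers survive, so a partial result is still there after the next subexpression has
been computed. -/
theorem runs_compile (e : LoopExpr) : ∀ (d : ℕ) (s : RAMState),
    Runs (e.compile d) s (e.cost.eval (s.reg 1)) fun s' =>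
      s'.reg (2 * d + 3) = e.eval (s.reg 1) s.mem (fun x => s.reg (2 * x + 2)) ∧
      s'.mem = s.mem ∧ ∀ r, r % 2 = 0 ∨ r < 2 * d + 3 → s'.reg r = s.reg r := by
  induction e with
  | var x =>
    intro d s
    simp only [cost, Polynomial.eval_one]
    refine .copy ⟨by simp [eval], rfl, fun r hr => ?_⟩
    simp only [RAMState.setReg_reg]; grind
  | size =>
    intro d s
    simp only [cost, Polynomial.eval_one]
    refine .copy ⟨by simp [eval], rfl, fun r hr => ?_⟩
    simp only [RAMState.setReg_reg]; grind
  | const c =>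
    intro d s
    simp only [cost, Polynomial.eval_one]
    refine .const ⟨by simp [eval], rfl, fun r hr => ?_⟩
    simp only [RAMState.setReg_reg]; grind
  | add a b iha ihb =>
    intro d s
    simp only [cost, Polynomial.eval_one, Polynomial.eval_add]
    refine (iha d s).seq fun s₁ ⟨h1, h2, h3⟩ => ?_
    have hN : s₁.reg 1 = s.reg 1 := h3 _ (by omega)
    have henv : (fun x => s₁.reg (2 * x + 2)) = fun x => s.reg (2 * x + 2) :=
      funext fun x => h3 _ (by omega)
    have := ihb (d + 1) s₁
    rw [hN, henv, h2] at this
    refine this.seq fun s₂ ⟨k1, k2, k3⟩ => .add ⟨?_, by simp [k2], fun r hr => ?_⟩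
    · have : s₂.reg (2 * d + 3) = s₁.reg (2 * d + 3) := k3 _ (by omega)
      have k1' : s₂.reg (2 * d + 5) = _ := k1
      simp [eval, this, h1, k1']
    · have := h3 r (by omega)
      have := k3 r (by omega)
      simp only [RAMState.setReg_reg]; grind
  | sub a b iha ihb =>
    intro d s
    simp only [cost, Polynomial.eval_one, Polynomial.eval_add]
    refine (iha d s).seq fun s₁ ⟨h1, h2, h3⟩ => ?_
    have hN : s₁.reg 1 = s.reg 1 := h3 _ (by omega)
    have henv : (fun x => s₁.reg (2 * x + 2)) = fun x => s.reg (2 * x + 2) :=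
      funext fun x => h3 _ (by omega)
    have := ihb (d + 1) s₁
    rw [hN, henv, h2] at this
    refine this.seq fun s₂ ⟨k1, k2, k3⟩ => .sub ⟨?_, by simp [k2], fun r hr => ?_⟩
    · have : s₂.reg (2 * d + 3) = s₁.reg (2 * d + 3) := k3 _ (by omega)
      have k1' : s₂.reg (2 * d + 5) = _ := k1
      simp [eval, this, h1, k1']
    · have := h3 r (by omega)
      have := k3 r (by omega)
      simp only [RAMState.setReg_reg]; grind
  | load a iha =>
    intro d s
    simp only [cost, Polynomial.eval_one, Polynomial.eval_add]
    refine (iha d s).seq fun s₁ ⟨h1, h2, h3⟩ => .load ⟨?_, h2, fun r hr => ?_⟩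
    · simp [eval, h1, h2]
    · have := h3 r (by omega)
      simp only [RAMState.setReg_reg]; grind
  | sum x e ih =>
    intro d s
    set N := s.reg 1 with hN
    have hcost : (sum x e).cost.eval N = 1 + (1 + (1 + (1 + ((N * ((e.cost.eval N +
        (1 + (1 + (1 + 1)))) + 1) + 1) + 1)))) := by
      simp only [cost, Polynomial.eval_add, Polynomial.eval_mul, Polynomial.eval_X,
        Polynomial.eval_ofNat]
      ring
    rw [hcost]
    let env : ℕ → ℕ := fun y => s.reg (2 * y + 2)
    -- The invariant with `j` rounds remaining. The loop variable is exempt from the frame condition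
    -- until it is restored at the end.
    let I : ℕ → RAMState → Prop := fun j s' =>
      j ≤ N ∧ s'.reg (2 * d + 5) = j ∧ s'.reg (2 * x + 2) = N - j ∧
      s'.reg (2 * d + 7) = s.reg (2 * x + 2) ∧
      s'.reg (2 * d + 3) = ∑ v ∈ Finset.range (N - j), e.eval N s.mem (Function.update env x v) ∧
      s'.mem = s.mem ∧ ∀ r, r % 2 = 0 ∨ r < 2 * d + 3 → r ≠ 2 * x + 2 → s'.reg r = s.reg r
    refine Runs.seq (.const (Q := fun s' => s' = s.setReg (2 * d + 3) 0) rfl) ?_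
    rintro _ rfl
    refine Runs.seq (.copy (Q := fun s' => s' = _) rfl) ?_
    rintro _ rfl
    refine Runs.seq (.copy (Q := fun s' => s' = _) rfl) ?_
    rintro _ rfl
    refine Runs.seq (.const (Q := fun s' => s' = _) rfl) ?_
    rintro _ rfl
    refine Runs.seq (Runs.loop I (fun j s h => h.2.1) ?_ N _ ?_) ?_
    · rintro j s' ⟨h1, h2, h3, h4, h5, h6, h7⟩
      have hN' : s'.reg 1 = N := h7 _ (by omega) (by omega)
      have henv : (fun y => s'.reg (2 * y + 2)) = Function.update env x (N - (j + 1)) := by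
        funext y
        by_cases hy : y = x
        · subst hy; simp [h3]
        · simp only [Function.update_of_ne hy, env]
          exact h7 _ (by omega) (by omega)
      have := ih (d + 3) s'
      rw [hN', henv, h6] at this
      refine this.seq fun s₂ ⟨k1, k2, k3⟩ => ?_
      have k1' : s₂.reg (2 * d + 9) = _ := k1
      show Runs _ _ (1 + (1 + (1 + 1))) _
      refine Runs.seq (.add (Q := fun s' => s' = _) rfl) ?_
      rintro _ rfl
      refine Runs.seq (.const (Q := fun s' => s' = _) rfl) ?_
      rintro _ rfl
      refine Runs.seq (.add (Q := fun s' => s' = _) rfl) ?_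
      rintro _ rfl
      have e5 := k3 (2 * d + 5) (by omega)
      have e7 := k3 (2 * d + 7) (by omega)
      have e3 := k3 (2 * d + 3) (by omega)
      have ex := k3 (2 * x + 2) (by omega)
      have hj : N - j = N - (j + 1) + 1 := by omega
      refine .sub ⟨by omega, ?_, ?_, ?_, ?_, by simp [k2], fun r hr hr' => ?_⟩
      · simp only [RAMState.setReg_reg]; grind
      · simp only [RAMState.setReg_reg]; grind
      · simp only [RAMState.setReg_reg]; grind
      · rw [hj, Finset.sum_range_succ]
        simp only [RAMState.setReg_reg]; grind
      · have := h7 r hr hr'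
        have := k3 r (by omega)
        simp only [RAMState.setReg_reg]; grind
    · refine ⟨le_rfl, ?_, ?_, ?_, ?_, rfl, fun r hr hr' => ?_⟩ <;>
        simp only [RAMState.setReg_reg, Nat.sub_self, Finset.range_zero, Finset.sum_empty] <;> grind
    · rintro s' ⟨h1, h2, h3, h4, h5, h6, h7⟩
      refine .copy ⟨?_, h6, fun r hr => ?_⟩
      · simp only [RAMState.setReg_reg]
        rw [if_neg (by omega), h5]; rfl
      · have := h7 r hr
        simp only [RAMState.setReg_reg]; grind

end LoopExpr

/-- Statements that write to the memory, with bounded loops. The loop variables are read-only. -/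
inductive LoopStmt : Type
  | store (a e : LoopExpr) : LoopStmt
  | seq (b c : LoopStmt) : LoopStmt
  /-- run `b` if the value of `e` is `0` -/
  | guard (e : LoopExpr) (b : LoopStmt) : LoopStmt
  /-- run `b` with the variable `x` ranging over the numbers below the size -/
  | forRange (x : ℕ) (b : LoopStmt) : LoopStmt

namespace LoopStmt

/-- The effect of a statement on the memory. -/
def exec (N : ℕ) : LoopStmt → (ℕ → ℕ) → (ℕ → ℕ) → ℕ → ℕ
  | store a e, env, mem => Function.update mem (a.eval N mem env) (e.eval N mem env)
  | seq b c, env, mem => c.exec N env (b.exec N env mem)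
  | guard e b, env, mem => if e.eval N mem env = 0 then b.exec N env mem else mem
  | forRange x b, env, mem => foldRange (fun v m => b.exec N (Function.update env x v) m) N mem

/-- The program of a statement, using the scratch registers from `2 * d + 3` on. -/
def compile : LoopStmt → ℕ → RAMProgram
  | store a e, d => .seq (a.compile d) (.seq (e.compile (d + 1)) (.store (2 * d + 3) (2 * d + 5)))
  | seq b c, d => .seq (b.compile d) (c.compile d)
  | guard e b, d => .seq (e.compile d) (.cond (2 * d + 3) .skip (b.compile d))
  | forRange x b, d =>
      -- Register `2 * d + 3` counts down and `2 * d + 5` saves the variable, so the body gets the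
      -- scratch registers from `2 * d + 7` on.
      .seq (.copy (2 * d + 3) 1) <| .seq (.copy (2 * d + 5) (2 * x + 2)) <|
      .seq (.const (2 * x + 2) 0) <|
      .seq (.loop (2 * d + 3) <| .seq (b.compile (d + 2)) <| .seq (.const (2 * d + 7) 1) <|
        .seq (.add (2 * x + 2) (2 * x + 2) (2 * d + 7))
          (.sub (2 * d + 3) (2 * d + 3) (2 * d + 7)))
      (.copy (2 * x + 2) (2 * d + 5))

/-- A bound on the number of steps, as a polynomial in the size. -/
noncomputable def cost : LoopStmt → Polynomial ℕ
  | store a e => a.cost + (e.cost + 1)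
  | seq b c => b.cost + c.cost
  | guard e b => e.cost + (b.cost + 1 + 1)
  | forRange _ b => 5 + Polynomial.X * (b.cost + 4)

theorem runs_compile (b : LoopStmt) : ∀ (d : ℕ) (s : RAMState),
    Runs (b.compile d) s (b.cost.eval (s.reg 1)) fun s' =>
      s'.mem = b.exec (s.reg 1) (fun x => s.reg (2 * x + 2)) s.mem ∧
      ∀ r, r % 2 = 0 ∨ r < 2 * d + 3 → s'.reg r = s.reg r := by
  induction b with
  | store a e =>
    intro d s
    simp only [cost, Polynomial.eval_one, Polynomial.eval_add]
    refine (a.runs_compile d s).seq fun s₁ ⟨h1, h2, h3⟩ => ?_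
    have hN : s₁.reg 1 = s.reg 1 := h3 _ (by omega)
    have henv : (fun x => s₁.reg (2 * x + 2)) = fun x => s.reg (2 * x + 2) :=
      funext fun x => h3 _ (by omega)
    have := e.runs_compile (d + 1) s₁
    rw [hN, henv, h2] at this
    refine this.seq fun s₂ ⟨k1, k2, k3⟩ => .store ⟨?_, fun r hr => ?_⟩
    · have : s₂.reg (2 * d + 3) = s₁.reg (2 * d + 3) := k3 _ (by omega)
      have k1' : s₂.reg (2 * d + 5) = _ := k1
      simp [exec, this, h1, k1', k2]
    · simp only [RAMState.setMem_reg]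
      rw [k3 r (by omega), h3 r hr]
  | seq b c ihb ihc =>
    intro d s
    simp only [cost, Polynomial.eval_add]
    refine (ihb d s).seq fun s₁ ⟨h1, h3⟩ => ?_
    have hN : s₁.reg 1 = s.reg 1 := h3 _ (by omega)
    have henv : (fun x => s₁.reg (2 * x + 2)) = fun x => s.reg (2 * x + 2) :=
      funext fun x => h3 _ (by omega)
    have := ihc d s₁
    rw [hN, henv, h1] at this
    refine this.mono le_rfl fun s₂ ⟨k1, k3⟩ => ⟨k1, fun r hr => ?_⟩
    rw [k3 r hr, h3 r hr]
  | guard e b ih =>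
    intro d s
    simp only [cost, Polynomial.eval_one, Polynomial.eval_add]
    refine (e.runs_compile d s).seq fun s₁ ⟨h1, h2, h3⟩ => ?_
    have hN : s₁.reg 1 = s.reg 1 := h3 _ (by omega)
    have henv : (fun x => s₁.reg (2 * x + 2)) = fun x => s.reg (2 * x + 2) :=
      funext fun x => h3 _ (by omega)
    refine .cond (fun h => ?_) (fun h => ?_)
    · refine (Runs.skip (Q := fun s' => s' = s₁) rfl).mono (by omega) ?_
      rintro _ rfl
      exact ⟨by rw [exec, if_neg (h1 ▸ h), h2], h3⟩
    · have := ih d s₁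
      rw [hN, henv, h2] at this
      refine this.mono (by omega) fun s₂ ⟨k1, k3⟩ => ⟨?_, fun r hr => ?_⟩
      · rw [exec, if_pos (h1 ▸ h), k1]
      · rw [k3 r hr, h3 r hr]
  | forRange x b ih =>
    intro d s
    set N := s.reg 1 with hN
    have hcost : (forRange x b).cost.eval N = 1 + (1 + (1 + ((N * ((b.cost.eval N +
        (1 + (1 + 1))) + 1) + 1) + 1))) := by
      simp only [cost, Polynomial.eval_add, Polynomial.eval_mul, Polynomial.eval_X,
        Polynomial.eval_ofNat]
      ring
    rw [hcost]
    let env : ℕ → ℕ := fun y => s.reg (2 * y + 2)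
    let I : ℕ → RAMState → Prop := fun j s' =>
      j ≤ N ∧ s'.reg (2 * d + 3) = j ∧ s'.reg (2 * x + 2) = N - j ∧
      s'.reg (2 * d + 5) = s.reg (2 * x + 2) ∧
      s'.mem = foldRange (fun v m => b.exec N (Function.update env x v) m) (N - j) s.mem ∧
      ∀ r, r % 2 = 0 ∨ r < 2 * d + 3 → r ≠ 2 * x + 2 → s'.reg r = s.reg r
    refine Runs.seq (.copy (Q := fun s' => s' = _) rfl) ?_
    rintro _ rfl
    refine Runs.seq (.copy (Q := fun s' => s' = _) rfl) ?_
    rintro _ rfl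
    refine Runs.seq (.const (Q := fun s' => s' = _) rfl) ?_
    rintro _ rfl
    refine Runs.seq (Runs.loop I (fun j s h => h.2.1) ?_ N _ ?_) ?_
    · rintro j s' ⟨h1, h2, h3, h4, h6, h7⟩
      have hN' : s'.reg 1 = N := h7 _ (by omega) (by omega)
      have henv : (fun y => s'.reg (2 * y + 2)) = Function.update env x (N - (j + 1)) := by
        funext y
        by_cases hy : y = x
        · subst hy; simp [h3]
        · simp only [Function.update_of_ne hy, env]
          exact h7 _ (by omega) (by omega)
      have := ih (d + 2) s'
      rw [hN', henv, h6] at this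
      refine this.seq fun s₂ ⟨k2, k3⟩ => ?_
      show Runs _ _ (1 + (1 + 1)) _
      refine Runs.seq (.const (Q := fun s' => s' = _) rfl) ?_
      rintro _ rfl
      refine Runs.seq (.add (Q := fun s' => s' = _) rfl) ?_
      rintro _ rfl
      have e5 := k3 (2 * d + 5) (by omega)
      have e3 := k3 (2 * d + 3) (by omega)
      have ex := k3 (2 * x + 2) (by omega)
      have hj : N - j = N - (j + 1) + 1 := by omega
      refine .sub ⟨by omega, ?_, ?_, ?_, ?_, fun r hr hr' => ?_⟩
      · simp only [RAMState.setReg_reg]; grind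
      · simp only [RAMState.setReg_reg]; grind
      · simp only [RAMState.setReg_reg]; grind
      · rw [hj]; simpa [foldRange] using k2
      · have := h7 r hr hr'
        have := k3 r (by omega)
        simp only [RAMState.setReg_reg]; grind
    · refine ⟨le_rfl, ?_, ?_, ?_, ?_, fun r hr hr' => ?_⟩
      · simp only [RAMState.setReg_reg]; grind
      · simp only [RAMState.setReg_reg]; grind
      · simp only [RAMState.setReg_reg]; grind
      · simp [foldRange]
      · simp only [RAMState.setReg_reg]; grind
    · rintro s' ⟨h1, h2, h3, h4, h6, h7⟩
      refine .copy ⟨?_, fun r hr => ?_⟩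
      · simpa [exec] using h6
      · have := h7 r hr
        simp only [RAMState.setReg_reg]; grind

end LoopStmt

theorem Polynomial.eval_mono_nat (q : Polynomial ℕ) {a b : ℕ} (h : a ≤ b) :
    q.eval a ≤ q.eval b := by
  rw [Polynomial.eval_eq_sum, Polynomial.eval_eq_sum]
  exact Finset.sum_le_sum fun i _ => Nat.mul_le_mul_left _ (Nat.pow_le_pow_left h i)

/-- A property decided by a statement of the loop language is decidable in polynomial time, if the
first number of the input is the size of the loops and at most the input size. -/
theorem decidableInPolyTime_of_loopStmt {α : Type} {enc : α → List ℕ} {P : α → Prop}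
    (b : LoopStmt) (e : LoopExpr) (hsize : ∀ a, (enc a).getD 0 0 ≤ inputSize (enc a))
    (hpos : ∀ a, P a → e.eval ((enc a).getD 0 0)
      (b.exec ((enc a).getD 0 0) 0 fun x => (enc a).getD x 0) 0 = 1)
    (hneg : ∀ a, ¬ P a → e.eval ((enc a).getD 0 0)
      (b.exec ((enc a).getD 0 0) 0 fun x => (enc a).getD x 0) 0 = 0) :
    DecidableInPolyTime enc P := by
  -- Register `3` is initially `0`, so the first instruction loads the first number of the input as
  -- the size. At the end register `3` is the scratch register holding the value of `e`.
  refine ⟨.seq (.load 1 3) (.seq (b.compile 0) (.seq (e.compile 0) (.copy 0 3))),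
    1 + (b.cost + (e.cost + 1)), fun a => ?_⟩
  set N := (enc a).getD 0 0 with hN
  suffices h : Runs (.seq (.load 1 3) (.seq (b.compile 0) (.seq (e.compile 0) (.copy 0 3))))
      (RAMState.init (enc a)) (1 + (b.cost.eval N + (e.cost.eval N + 1))) fun s =>
        s.reg 0 = e.eval N (b.exec N 0 fun x => (enc a).getD x 0) 0 by
    obtain ⟨s, t, h1, h2, h3⟩ := h
    refine ⟨s, t, h1, h2.trans ?_, fun h => h3.trans (hpos a h), fun h => h3.trans (hneg a h)⟩
    have hb := b.cost.eval_mono_nat (hsize a)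
    have he := e.cost.eval_mono_nat (hsize a)
    rw [← hN] at hb he
    simp only [Polynomial.eval_add, Polynomial.eval_one]
    omega
  refine Runs.seq (.load (Q := fun s' => s' = _) rfl) ?_
  rintro _ rfl
  have key := b.runs_compile 0
    ((RAMState.init (enc a)).setReg 1 ((RAMState.init (enc a)).mem ((RAMState.init (enc a)).reg 3)))
  have h1 : ((RAMState.init (enc a)).setReg 1
      ((RAMState.init (enc a)).mem ((RAMState.init (enc a)).reg 3))).reg 1 = N := by
    simp [RAMState.init, hN]
  have h2 : (fun x => ((RAMState.init (enc a)).setReg 1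
      ((RAMState.init (enc a)).mem ((RAMState.init (enc a)).reg 3))).reg (2 * x + 2)) = 0 := by
    funext x
    simp [RAMState.init]
  rw [h1, h2] at key
  refine key.seq fun s₁ ⟨k1, k2⟩ => ?_
  have key' := e.runs_compile 0 s₁
  have h3 : s₁.reg 1 = N := (k2 1 (by omega)).trans h1
  have h4 : (fun x => s₁.reg (2 * x + 2)) = 0 := by
    rw [← h2]; exact funext fun x => k2 _ (by omega)
  rw [h3, h4] at key'
  refine key'.seq fun s₂ ⟨l1, l2, l3⟩ => .copy ?_
  have l1' : s₂.reg 3 = _ := l1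
  simp [l1', k1]
  rfl

/-! ## Improvement cycles of deterministic assignments -/

namespace Profile

variable {n : ℕ} {pref : Profile n} {d : Equiv.Perm (Fin n)}

/-- Under the assignment `d`, agent `a` strictly prefers the object of agent `b` to his own. -/
def Envies (pref : Profile n) (d : Equiv.Perm (Fin n)) (a b : Fin n) : Prop :=
  pref.Strict a (d b) (d a)

/-- This is what shortens cycles: of two agents of one type, the one with the worse object inherits
the envy of the other. -/
theorem Envies.of_pref_eq {a a' b : Fin n} (h : pref.Envies d a b) (hp : pref a = pref a')
    (hle : (pref a).symm (d a) ≤ (pref a).symm (d a')) : pref.Envies d a' b := by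
  unfold Envies Strict at *
  rw [← hp]
  exact h.trans_le hle

/-- An infinite sequence of agents, each envying the next one, of period `m`. -/
structure IsEnvyWalk (pref : Profile n) (d : Equiv.Perm (Fin n)) (f : ℕ → Fin n) (m : ℕ) :
    Prop where
  pos : 0 < m
  periodic : Function.Periodic f m
  envies : ∀ j, pref.Envies d (f j) (f (j + 1))

/-- The chord from `f (j + e)` back to `f (j + 1)` closes the segment between them into a walk of
its own. -/
theorem IsEnvyWalk.shortcut {f : ℕ → Fin n} {m : ℕ} (hf : pref.IsEnvyWalk d f m) {j e : ℕ}
    (he : 0 < e) (h : pref.Envies d (f (j + e)) (f (j + 1))) :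
    pref.IsEnvyWalk d (fun x => f (j + 1 + x % e)) e where
  pos := he
  periodic := fun x => by simp
  envies := fun x => by
    rcases Nat.lt_or_ge (x % e + 1) e with hx | hx
    · have : (x + 1) % e = x % e + 1 := by
        rw [Nat.add_mod, Nat.mod_eq_of_lt (show 1 < e by omega), Nat.mod_eq_of_lt hx]
      simp only [this]
      exact hf.envies (j + 1 + x % e)
    · have hlt := Nat.mod_lt x he
      have hxe : x % e = e - 1 := by omega
      have : (x + 1) % e = 0 := by
        rw [Nat.add_mod, hxe]
        rcases Nat.lt_or_ge 1 e with h1 | h1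
        · rw [Nat.mod_eq_of_lt h1, Nat.sub_add_cancel he, Nat.mod_self]
        · rw [show e = 1 by omega]
      simp only [this, hxe]
      rw [show j + 1 + (e - 1) = j + e by omega]
      exact h

/-- A shortest envy walk visits at most one agent of each type in a period. -/
theorem exists_isEnvyWalk_injOn {f : ℕ → Fin n} {m : ℕ} (hf : pref.IsEnvyWalk d f m) :
    ∃ g l, pref.IsEnvyWalk d g l ∧ Set.InjOn (fun j => pref (g j)) (Set.Iio l) := by
  classical
  have hex : ∃ l, ∃ g, pref.IsEnvyWalk d g l := ⟨m, f, hf⟩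
  obtain ⟨g, hg⟩ := Nat.find_spec hex
  refine ⟨g, _, hg, ?_⟩
  set l := Nat.find hex with hl
  have hmin : ∀ (j e : ℕ), 0 < e → e < l → ¬ pref.Envies d (g (j + e)) (g (j + 1)) :=
    fun j e h1 h2 h => Nat.find_min hex h2 ⟨_, hg.shortcut h1 h⟩
  have key : ∀ i j, i < j → j < l → pref (g i) ≠ pref (g j) := by
    intro i j hij hj hp
    -- If `g j` has the worse object, he envies `g (i + 1)`, which closes the segment from `i + 1`
    -- to `j`. Otherwise `g i = g (i + l)` envies `g (j + 1)`, which closes the complementary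
    -- segment from `j + 1` to `i + l`.
    rcases le_total ((pref (g i)).symm (d (g i))) ((pref (g i)).symm (d (g j))) with h | h
    · refine hmin i (j - i) (by omega) (by omega) ?_
      rw [show i + (j - i) = j by omega]
      exact (hg.envies i).of_pref_eq hp h
    · refine hmin j (l - (j - i)) (by omega) (by omega) ?_
      rw [show j + (l - (j - i)) = i + l by omega, hg.periodic i]
      rw [hp] at h
      exact (hg.envies j).of_pref_eq hp.symm h
  intro i hi j hj hp
  by_contra hne
  rcases lt_or_gt_of_ne hne with h | h
  · exact key i j h hj hp
  · exact key j i h hi hp.symm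

/-- If `e` dominates `d`, then `d⁻¹ * e` maps each agent to the owner under `d` of his new object.
Preferences being strict, every agent it moves envies his image, so the orbit of a strictly
improving agent is an envy walk. -/
theorem exists_isEnvyWalk_of_not_paretoOptimal (h : ¬ pref.ParetoOptimal d) :
    ∃ f m, pref.IsEnvyWalk d f m := by
  obtain ⟨e, hw, i, hi⟩ := not_not.mp h
  set τ : Equiv.Perm (Fin n) := d⁻¹ * e with hτ
  have hd : ∀ a, d (τ a) = e a := fun a => by simp [hτ]
  have henv : ∀ a, τ a ≠ a → pref.Envies d a (τ a) := by
    intro a ha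
    have h1 := hw a
    unfold Weak Strict at h1
    unfold Envies Strict
    rw [hd]
    refine lt_of_le_of_ne (not_lt.mp h1) fun h2 => ha ?_
    have := (pref a).symm.injective h2
    rw [← hd] at this
    exact d.injective this
  have hi' : τ i ≠ i := by
    intro h2
    rw [← hd, h2] at hi
    exact lt_irrefl _ hi
  refine ⟨fun j => (τ ^ j) i, orderOf τ, orderOf_pos τ, fun j => ?_, fun j => ?_⟩
  · simp [pow_add, pow_orderOf_eq_one]
  · simp only [pow_succ', Equiv.Perm.mul_apply]
    refine henv _ fun h2 => hi' ?_
    rw [← Equiv.Perm.mul_apply, ← pow_succ', pow_succ, Equiv.Perm.mul_apply] at h2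
    exact (τ ^ j).injective h2

/-- Passing the objects along the cycle improves every agent on it and changes nothing elsewhere. -/
theorem not_paretoOptimal_of_cycle {m : ℕ} {w : Fin (m + 1) → Fin n} (hw : Function.Injective w)
    (henv : ∀ j, pref.Envies d (w j) (w (j + 1))) : ¬ pref.ParetoOptimal d := by
  classical
  set c : Equiv.Perm (Fin n) := (finRotate (m + 1)).extendDomain (Equiv.ofInjective w hw) with hc
  have h1 : ∀ j, c (w j) = w (j + 1) := by
    intro j
    have := Equiv.Perm.extendDomain_apply_image (finRotate (m + 1)) (Equiv.ofInjective w hw) j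
    simpa [finRotate_apply] using this
  have h2 : ∀ a, a ∉ Set.range w → c a = a := fun a ha =>
    Equiv.Perm.extendDomain_apply_not_subtype _ _ ha
  refine not_not.mpr ⟨d * c, fun a => ?_, w 0, ?_⟩
  · by_cases ha : a ∈ Set.range w
    · obtain ⟨j, rfl⟩ := ha
      rw [Equiv.Perm.mul_apply, h1]
      exact (henv j).le.not_gt
    · rw [Equiv.Perm.mul_apply, h2 a ha]
      exact lt_irrefl _
  · rw [Equiv.Perm.mul_apply, h1]
    exact henv 0

theorem IsEnvyWalk.exists_cycle {f : ℕ → Fin n} {m : ℕ} (hf : pref.IsEnvyWalk d f m) :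
    ∃ (m : ℕ) (w : Fin (m + 1) → Fin n), (∀ j, pref.Envies d (w j) (w (j + 1))) ∧
      ∀ j l, pref (w j) = pref (w l) → j = l := by
  obtain ⟨g, l, hg, hinj⟩ := exists_isEnvyWalk_injOn hf
  obtain ⟨m, rfl⟩ : ∃ m, l = m + 1 := ⟨l - 1, by have := hg.pos; omega⟩
  refine ⟨m, fun j => g j, fun j => ?_, fun j l h => Fin.ext (hinj j.2 l.2 h)⟩
  have := hg.envies j
  beta_reduce
  rw [Fin.val_add_one]
  split_ifs with hj
  · rw [hj, Fin.val_last] at this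
    rw [hj, Fin.val_last]
    have h0 := hg.periodic 0
    rw [zero_add] at h0
    rwa [← h0]
  · exact this

/-- An assignment is not Pareto optimal if and only if it has an envy cycle with at most one agent
of each type. -/
theorem not_paretoOptimal_iff : ¬ pref.ParetoOptimal d ↔
    ∃ (m : ℕ) (w : Fin (m + 1) → Fin n), (∀ j, pref.Envies d (w j) (w (j + 1))) ∧
      ∀ j l, pref (w j) = pref (w l) → j = l := by
  constructor
  · intro h
    obtain ⟨f, m, hf⟩ := exists_isEnvyWalk_of_not_paretoOptimal h
    exact hf.exists_cycle
  · rintro ⟨m, w, h1, h2⟩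
    exact not_paretoOptimal_of_cycle (fun j l h => h2 j l (congrArg pref h)) h1

end Profile

/-! ## Decompositions and supports -/

section Decomposition

variable {n : ℕ} {p : Matrix (Fin n) (Fin n) ℝ}

theorem Decomposition.apply_pos (D : Decomposition p) (j : Fin D.len) (i : Fin n) :
    0 < p i (D.assign j i) := by
  have h : p i (D.assign j i) =
      ∑ l, (D.weight l • (D.assign l).permMatrix ℝ) i (D.assign j i) := by
    conv_lhs => rw [show p i = (∑ l, D.weight l • (D.assign l).permMatrix ℝ) i from
      congrFun D.eq_sum i]
    rw [Matrix.sum_apply]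
  rw [h]
  refine Finset.sum_pos' (fun l _ => ?_) ⟨j, Finset.mem_univ _, ?_⟩
  · simp only [Matrix.smul_apply, smul_eq_mul]
    refine mul_nonneg (D.weight_pos l).le ?_
    simp only [Equiv.Perm.permMatrix, PEquiv.toMatrix_apply]
    split_ifs <;> norm_num
  · simpa [Equiv.Perm.permMatrix, PEquiv.toMatrix_apply] using D.weight_pos j

/-- Every deterministic assignment in the support of a random assignment occurs in one of its
decompositions. -/
theorem exists_decomposition (hp : p ∈ doublyStochastic ℝ (Fin n)) (d : Equiv.Perm (Fin n))
    (hd : ∀ i, 0 < p i (d i)) : ∃ (D : Decomposition p) (j : Fin D.len), D.assign j = d := by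
  -- The weight reserved for `d`: small enough that `p` minus `ε` times `d` is nonnegative, and
  -- below `1` so that this remainder can be rescaled to a doubly stochastic matrix.
  obtain ⟨ε, hε0, hε1, hε⟩ : ∃ ε : ℝ, 0 < ε ∧ ε < 1 ∧ ∀ i, ε ≤ p i (d i) := by
    obtain ⟨ε, h0, h⟩ : ∃ ε : ℝ, 0 < ε ∧ ∀ i, ε ≤ p i (d i) := by
      rcases isEmpty_or_nonempty (Fin n) with hn | hn
      · exact ⟨1, one_pos, fun i => hn.elim i⟩
      · obtain ⟨i, hi⟩ := Finite.exists_min fun i => p i (d i)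
        exact ⟨_, hd i, hi⟩
    refine ⟨min ε (1 / 2), lt_min h0 (by norm_num), (min_le_right _ _).trans_lt (by norm_num),
      fun i => (min_le_left _ _).trans (h i)⟩
  have hε' : 0 < 1 - ε := by linarith
  have hP := permMatrix_mem_doublyStochastic (R := ℝ) (σ := d)
  have hq : (1 - ε)⁻¹ • (p - ε • d.permMatrix ℝ) ∈ doublyStochastic ℝ (Fin n) := by
    rw [mem_doublyStochastic_iff_sum] at hp hP ⊢
    refine ⟨fun i o => ?_, fun i => ?_, fun o => ?_⟩
    · simp only [Matrix.smul_apply, Matrix.sub_apply, smul_eq_mul]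
      refine mul_nonneg (inv_nonneg.mpr hε'.le) (sub_nonneg.mpr ?_)
      by_cases h : d i = o
      · subst h; simpa [Equiv.Perm.permMatrix, PEquiv.toMatrix_apply] using hε i
      · simpa [Equiv.Perm.permMatrix, PEquiv.toMatrix_apply, h] using hp.1 i o
    · simp only [Matrix.smul_apply, Matrix.sub_apply, smul_eq_mul, ← Finset.mul_sum,
        Finset.sum_sub_distrib, hp.2.1, hP.2.1]
      field_simp
    · simp only [Matrix.smul_apply, Matrix.sub_apply, smul_eq_mul, ← Finset.mul_sum,
        Finset.sum_sub_distrib, hp.2.2, hP.2.2]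
      field_simp
  obtain ⟨w, hw0, hw1, hw⟩ := exists_eq_sum_perm_of_mem_doublyStochastic hq
  set v : Equiv.Perm (Fin n) → ℝ := fun σ => (1 - ε) * w σ + if σ = d then ε else 0 with hv
  have hv0 : ∀ σ, 0 ≤ v σ := fun σ => by
    simp only [hv]; have := mul_nonneg hε'.le (hw0 σ); split_ifs <;> linarith
  have hvd : 0 < v d := by
    simp only [hv, if_true]; have := mul_nonneg hε'.le (hw0 d); linarith
  have hv1 : ∑ σ, v σ = 1 := by
    simp only [hv, Finset.sum_add_distrib, ← Finset.mul_sum, hw1, Finset.sum_ite_eq',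
      Finset.mem_univ, if_true]
    ring
  have hvp : ∑ σ, v σ • σ.permMatrix ℝ = p := by
    simp only [hv, add_smul, mul_smul, Finset.sum_add_distrib, ← Finset.smul_sum, hw, ite_smul,
      zero_smul, Finset.sum_ite_eq', Finset.mem_univ, if_true]
    rw [smul_inv_smul₀ hε'.ne']
    abel
  -- The weights of a decomposition must be positive, so permutations of weight `0` are dropped; `d`
  -- stays because its weight is at least `ε`.
  set S := Finset.univ.filter fun σ => 0 < v σ with hS
  have hout : ∀ σ, σ ∉ S → v σ = 0 := fun σ hσ => by
    simp only [hS, Finset.mem_filter, Finset.mem_univ, true_and, not_lt] at hσ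
    exact le_antisymm hσ (hv0 σ)
  have hsum : ∑ j : Fin S.card, v (S.equivFin.symm j) = 1 := by
    rw [← hv1, ← Finset.sum_subset (Finset.subset_univ S) fun σ _ h => hout σ h,
      ← Finset.sum_coe_sort S]
    exact Equiv.sum_comp S.equivFin.symm fun σ : S => v σ
  refine ⟨⟨S.card, fun j => v (S.equivFin.symm j), fun j => S.equivFin.symm j, fun j => ?_,
    fun j => ?_, hsum, ?_⟩, S.equivFin ⟨d, by simpa [hS] using hvd⟩, by simp⟩
  · exact (Finset.mem_filter.mp (S.equivFin.symm j).2).2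
  · rw [← hv1]
    exact Finset.single_le_sum (fun σ _ => hv0 σ) (Finset.mem_univ _)
  · rw [← hvp, ← Finset.sum_subset (Finset.subset_univ S) fun σ _ h => by simp [hout σ h],
      ← Finset.sum_coe_sort S]
    exact (Equiv.sum_comp S.equivFin.symm
      fun σ : S => v σ • (σ : Equiv.Perm (Fin n)).permMatrix ℝ).symm

/-- The permutations occurring in decompositions of `p` are exactly those in its support. -/
theorem not_robustExPostEfficient_iff {pref : Profile n} (hp : p ∈ doublyStochastic ℝ (Fin n)) :
    ¬ RobustExPostEfficient pref p ↔
      ∃ d : Equiv.Perm (Fin n), (∀ i, 0 < p i (d i)) ∧ ¬ pref.ParetoOptimal d := by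
  constructor
  · intro h
    simp only [RobustExPostEfficient, not_forall] at h
    obtain ⟨D, j, h⟩ := h
    exact ⟨D.assign j, D.apply_pos j, h⟩
  · rintro ⟨d, hd, h⟩ hr
    obtain ⟨D, j, rfl⟩ := exists_decomposition hp d hd
    exact h (hr D j)

/-- The test through short trading cycles is correct. -/
theorem robustExPostEfficient_iff {pref : Profile n} (hp : p ∈ doublyStochastic ℝ (Fin n)) :
    RobustExPostEfficient pref p ↔ ¬ ∃ c : TradingCycle pref p, c.Short ∧ c.RestMatchable := by
  classical
  rw [← not_iff_not, not_robustExPostEfficient_iff hp, not_not]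
  constructor
  · rintro ⟨d, hd, h⟩
    obtain ⟨m, w, h1, h2⟩ := Profile.not_paretoOptimal_iff.mp h
    have hw : Function.Injective w := fun j l h => h2 j l (congrArg pref h)
    refine ⟨⟨m, w, d ∘ w, hw, d.injective.comp hw, fun j => hd _, h1⟩, h2, ?_⟩
    refine ⟨d.subtypeEquiv fun i => ?_, fun i => hd _⟩
    simp [Set.range_comp]
  · rintro ⟨c, hs, m, hm⟩
    -- The non-optimal permutation is glued from the cycle, where each agent gets the object
    -- pointing to him, and the matching outside it.
    let e : {i // i ∈ Set.range c.agent} ≃ {o // o ∈ Set.range c.object} :=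
      (Equiv.ofInjective _ c.agent_injective).symm.trans (Equiv.ofInjective _ c.object_injective)
    let d : Equiv.Perm (Fin n) := Equiv.subtypeCongr e m
    have hd1 : ∀ j, d (c.agent j) = c.object j := by
      intro j
      have he : e ⟨c.agent j, j, rfl⟩ = ⟨c.object j, j, rfl⟩ := by
        have : (Equiv.ofInjective _ c.agent_injective).symm ⟨c.agent j, j, rfl⟩ = j :=
          Equiv.ofInjective_symm_apply c.agent_injective j
        simp only [e, Equiv.trans_apply, this]
        rfl
      simp only [d, Equiv.subtypeCongr, Equiv.trans_apply,
        Equiv.sumCompl_symm_apply_of_pos (p := (· ∈ Set.range c.agent)) ⟨j, rfl⟩]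
      simp [he]
    have hd2 : ∀ i (hi : i ∉ Set.range c.agent), d i = m ⟨i, hi⟩ := by
      intro i hi
      simp only [d, Equiv.subtypeCongr, Equiv.trans_apply,
        Equiv.sumCompl_symm_apply_of_neg (p := (· ∈ Set.range c.agent)) hi]
      simp
    refine ⟨d, fun i => ?_, Profile.not_paretoOptimal_iff.mpr ⟨c.len, c.agent, fun j => ?_, hs⟩⟩
    · by_cases hi : i ∈ Set.range c.agent
      · obtain ⟨j, rfl⟩ := hi
        rw [hd1]; exact c.consistent j
      · rw [hd2 i hi]; exact hm ⟨i, hi⟩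
    · rw [Profile.Envies, hd1, hd1]
      exact c.improves j

end Decomposition

/-! ## Counting short trading cycles -/

namespace TradingCycle

variable {n : ℕ} {pref : Profile n} {p : Matrix (Fin n) (Fin n) ℝ}

theorem Short.len_lt {c : TradingCycle pref p} (hc : c.Short) : c.len < pref.numTypes := by
  have h : Fintype.card (Fin (c.len + 1)) ≤ pref.numTypes := by
    rw [← Finset.card_univ]
    exact Finset.card_le_card_of_injOn (fun j => pref (c.agent j)) (fun j _ => by simp)
      fun j _ l _ h => hc j l h
  simpa using h

theorem encard_short_le {k : ℕ} (h : pref.numTypes ≤ k) :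
    {c : TradingCycle pref p | c.Short}.encard ≤ ((k * n ^ (2 * k) : ℕ) : ℕ∞) := by
  -- Both sequences are padded to length `k` by repeating the last entry; the recorded length makes
  -- this injective.
  let φ : {c : TradingCycle pref p // c.Short} → Fin k × (Fin k → Fin n × Fin n) := fun c =>
    (⟨c.1.len, c.2.len_lt.trans_le h⟩, fun x => (c.1.agent ⟨min x c.1.len, by omega⟩,
      c.1.object ⟨min x c.1.len, by omega⟩))
  have hφ : Function.Injective φ := by
    rintro ⟨⟨l, a, o, _, _, _, _⟩, hc⟩ ⟨⟨l', a', o', _, _, _, _⟩, hc'⟩ heq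
    simp only [φ, Prod.mk.injEq, Fin.mk.injEq] at heq
    obtain ⟨rfl, heq⟩ := heq
    have hl : l < k := hc.len_lt.trans_le h
    have key : ∀ j : Fin (l + 1), a j = a' j ∧ o j = o' j := by
      intro j
      have := congrFun heq ⟨j, by omega⟩
      have hj : min (j : ℕ) l = j := by omega
      simpa [hj] using this
    obtain rfl : a = a' := funext fun j => (key j).1
    obtain rfl : o = o' := funext fun j => (key j).2
    rfl
  have : Finite {c : TradingCycle pref p // c.Short} := Finite.of_injective φ hφ
  have hcard := Nat.card_le_card_of_injective φ hφ
  rw [Nat.card_eq_fintype_card (α := Fin k × _)] at hcard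
  simp only [Fintype.card_prod, Fintype.card_fin, Fintype.card_fun, ← pow_two, ← pow_mul] at hcard
  change (ENat.card {c : TradingCycle pref p // c.Short}) ≤ _
  rw [ENat.card_eq_coe_natCard]
  exact_mod_cast hcard

end TradingCycle

/-! ## Perfect matchings by auction -/

/-! ### Invariants and potentials for iterated maps. -/

section FoldRange

variable {α : Type*}

theorem foldRange_induction {f : ℕ → α → α} (I : α → Prop) {m : ℕ}
    (hf : ∀ v < m, ∀ a, I a → I (f v a)) {a : α} (ha : I a) : I (foldRange f m a) := by
  induction m with
  | zero => exact ha
  | succ m ih =>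
    exact hf m m.lt_succ_self _ (ih fun v hv => hf v (hv.trans m.lt_succ_self))

/-- If each step does nothing or increases the potential, then so does the whole fold. -/
theorem foldRange_fixed_or_lt {f : ℕ → α → α} (P : α → ℕ) {m : ℕ}
    (hf : ∀ v < m, ∀ a, f v a = a ∨ P a < P (f v a)) (a : α) :
    (foldRange f m a = a ∧ ∀ v < m, f v a = a) ∨ P a < P (foldRange f m a) := by
  induction m with
  | zero => exact .inl ⟨rfl, by simp⟩
  | succ m ih =>
    have hm := hf m m.lt_succ_self (foldRange f m a)
    rcases ih fun v hv => hf v (hv.trans m.lt_succ_self) with ⟨h1, h2⟩ | h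
    · rw [foldRange, h1]
      rcases hf m m.lt_succ_self a with h | h
      · refine .inl ⟨h, fun v hv => ?_⟩
        rcases Nat.lt_succ_iff_lt_or_eq.mp hv with hv | rfl
        exacts [h2 v hv, h]
      · exact .inr h
    · rw [foldRange]
      rcases hm with h' | h'
      · exact .inr (h'.symm ▸ h)
      · exact .inr (h.trans h')

/-- Used for both levels of the auction's rounds: either a stationary state is reached, or each of
the `m` iterations gains `c`. -/
theorem foldRange_const_fixed_or_le {g : α → α} (P : α → ℕ) (Q : α → Prop) {c : ℕ}
    (hQ : ∀ a, Q a → g a = a) (hg : ∀ a, Q (g a) ∨ P a + c ≤ P (g a)) (m : ℕ) (a : α) :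
    Q (foldRange (fun _ => g) m a) ∨ P a + m * c ≤ P (foldRange (fun _ => g) m a) := by
  induction m with
  | zero => right; simp [foldRange]
  | succ m ih =>
    rw [foldRange]
    rcases ih with h | h
    · rw [hQ _ h]; exact .inl h
    · rcases hg (foldRange (fun _ => g) m a) with h' | h'
      · exact .inl h'
      · right; rw [add_mul]; omega

end FoldRange

/-- The relation `A` contains the graph of an injection of the numbers below `N` to themselves. -/
def HasMatching (N : ℕ) (A : ℕ → ℕ → Prop) : Prop :=
  ∃ g : ℕ → ℕ, (∀ i < N, g i < N ∧ A i (g i)) ∧ Set.InjOn g (Set.Iio N)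

/-- The invariant of the auction: `pr o` is the price of the object `o`, and `ho o` is one more than
its holder, or `0` if nobody holds it. -/
structure AuctionInv (N : ℕ) (A : ℕ → ℕ → Prop) (pr ho : ℕ → ℕ) : Prop where
  inj : ∀ o < N, ∀ o' < N, ho o = ho o' → ho o ≠ 0 → o = o'
  slack : ∀ o < N, ∀ i, ho o = i + 1 → i < N ∧ A i o ∧ ∀ o' < N, A i o' → pr o ≤ pr o' + 1
  unheld : ∀ o < N, ho o = 0 → pr o = 0

/-- Agent `i` holds nothing, and `o` is a cheapest acceptable object for him. -/
def Bids (N : ℕ) (A : ℕ → ℕ → Prop) (pr ho : ℕ → ℕ) (i o : ℕ) : Prop :=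
  (∀ o' < N, ho o' ≠ i + 1) ∧ A i o ∧ ∀ o' < N, A i o' → pr o ≤ pr o'

namespace AuctionInv

variable {N : ℕ} {A : ℕ → ℕ → Prop} {pr ho : ℕ → ℕ}

/-- The object was cheapest for the bidder, so after the raise it is at most one above his minimum.
For other holders the raise only increases the price of an alternative, and a displaced holder is no
longer subject to `slack`. -/
theorem bid (h : AuctionInv N A pr ho) {i o : ℕ} (hi : i < N) (hb : Bids N A pr ho i o) :
    AuctionInv N A (Function.update pr o (pr o + 1)) (Function.update ho o (i + 1)) := by
  obtain ⟨h1, h2, h3⟩ := hb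
  refine ⟨fun x hx y hy hxy h0 => ?_, fun x hx j hj => ?_, fun x hx h0 => ?_⟩
  · have := h.inj x hx y hy
    have := h1 x hx
    have := h1 y hy
    simp only [Function.update_apply] at hxy h0
    grind
  · by_cases hxo : x = o
    · subst hxo
      simp only [Function.update_self, Nat.add_right_cancel_iff] at hj
      subst hj
      refine ⟨hi, h2, fun y hy hA => ?_⟩
      have := h3 y hy hA
      simp only [Function.update_apply]
      grind
    · rw [Function.update_of_ne hxo] at hj
      obtain ⟨k1, k2, k3⟩ := h.slack x hx j hj
      refine ⟨k1, k2, fun y hy hA => ?_⟩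
      have := k3 y hy hA
      simp only [Function.update_apply]
      grind
  · have := h.unheld x hx
    simp only [Function.update_apply] at h0 ⊢
    grind

theorem hasMatching (h : AuctionInv N A pr ho) (hall : ∀ i < N, ∃ o < N, ho o = i + 1) :
    HasMatching N A := by
  choose! g hg hho using hall
  refine ⟨g, fun i hi => ⟨hg i hi, (h.slack _ (hg i hi) i (hho i hi)).2.1⟩, fun i hi j hj hij => ?_⟩
  have h1 := hho i hi
  have h2 := hho j hj
  rw [hij] at h1
  omega

/-- As long as an agent holds nothing, prices are below `N`, because the objects of price at least
`t + 1` are fewer than those of price at least `t`. -/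
theorem price_lt (h : AuctionInv N A pr ho) (hM : HasMatching N A) {i o : ℕ} (hi : i < N)
    (hb : Bids N A pr ho i o) : pr o < N := by
  obtain ⟨g, hg, hinj⟩ := hM
  by_contra! hN
  have hheld : ∀ x < N, 0 < pr x → ho x = ho x - 1 + 1 := fun x hx h0 => by
    have := h.unheld x hx; omega
  have hmin : ∀ t ≤ N, t ≤ pr (g i) := fun t ht =>
    (ht.trans hN).trans (hb.2.2 _ (hg i hi).1 (hg i hi).2)
  have key : ∀ t ≤ N, ((Finset.range N).filter fun x => t ≤ pr x).card + t ≤ N := by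
    intro t
    induction t with
    | zero => simp
    | succ t ih =>
      intro ht
      have hN' : N ∉ (Finset.range N).filter fun x => t + 1 ≤ pr x := by simp
      -- Objects of price at least `t + 1` are held, and the matching `g` sends their holders to
      -- distinct objects of price at least `t`, by slackness. The extra element `N` stands for the
      -- unmatched bidder `i`, whose partner `g i` is different and also expensive.
      have hle : (insert N ((Finset.range N).filter fun x => t + 1 ≤ pr x)).card ≤
          ((Finset.range N).filter fun x => t ≤ pr x).card := by
        refine Finset.card_le_card_of_injOn (fun x => if x = N then g i else g (ho x - 1)) ?_ ?_
        · intro x hx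
          simp only [Finset.coe_insert, Finset.coe_filter, Finset.mem_range, Set.mem_insert_iff,
            Set.mem_ofPred_eq] at hx ⊢
          rcases hx with rfl | ⟨hx, hpx⟩
          · rw [if_pos rfl]
            exact ⟨(hg i hi).1, hmin t (by omega)⟩
          · rw [if_neg hx.ne]
            obtain ⟨k1, k2, k3⟩ := h.slack x hx _ (hheld x hx (by omega))
            have := k3 _ (hg _ k1).1 (hg _ k1).2
            exact ⟨(hg _ k1).1, by omega⟩
        · have hlt : ∀ x < N, t + 1 ≤ pr x → ho x - 1 < N := fun x hx hpx =>
            (h.slack x hx _ (hheld x hx (by omega))).1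
          have hne : ∀ x < N, t + 1 ≤ pr x → ho x - 1 ≠ i := fun x hx hpx he =>
            hb.1 x hx (by rw [hheld x hx (by omega), he])
          intro x hx y hy hxy
          simp only [Finset.coe_insert, Finset.coe_filter, Finset.mem_range, Set.mem_insert_iff,
            Set.mem_ofPred_eq] at hx hy hxy
          rcases hx with rfl | ⟨hx, hpx⟩ <;> rcases hy with rfl | ⟨hy, hpy⟩
          · rfl
          · rw [if_pos rfl, if_neg hy.ne] at hxy
            exact (hne y hy hpy (hinj hi (hlt y hy hpy) hxy).symm).elim
          · rw [if_pos rfl, if_neg hx.ne] at hxy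
            exact (hne x hx hpx (hinj (hlt x hx hpx) hi hxy)).elim
          · rw [if_neg hx.ne, if_neg hy.ne] at hxy
            have := hinj (hlt x hx hpx) (hlt y hy hpy) hxy
            have h1 := hheld x hx (by omega)
            have h2 := hheld y hy (by omega)
            exact h.inj x hx y hy (by omega) (by omega)
      rw [Finset.card_insert_of_notMem hN'] at hle
      have := ih (by omega)
      omega
  have h0 : ((Finset.range N).filter fun x => N ≤ pr x).card = 0 := by
    have := key N le_rfl; omega
  rw [Finset.card_eq_zero] at h0
  have : g i ∈ (Finset.range N).filter fun x => N ≤ pr x := by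
    simpa using ⟨(hg i hi).1, hmin N le_rfl⟩
  rw [h0] at this
  simp at this

end AuctionInv

/-- If nobody bids, then everybody holds an object. -/
theorem exists_holds_of_not_bids {N : ℕ} {A : ℕ → ℕ → Prop} {pr ho : ℕ → ℕ}
    (hM : HasMatching N A) (hb : ∀ i < N, ∀ o < N, ¬ Bids N A pr ho i o) :
    ∀ i < N, ∃ o < N, ho o = i + 1 := by
  classical
  obtain ⟨g, hg, -⟩ := hM
  intro i hi
  by_contra! hno
  obtain ⟨o, ho, hmin⟩ := Finset.exists_min_image ((Finset.range N).filter (A i)) pr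
    ⟨g i, by simpa using hg i hi⟩
  simp only [Finset.mem_filter, Finset.mem_range, and_imp] at ho hmin
  exact hb i hi o ho.1 ⟨hno, ho.2, hmin⟩

/-! ### The auction on a memory -/

section Memory

open Classical in
/-- Agent `i` takes the object `o` and raises its price, if he bids for it. The price of `o` is at
the address `D + 1 + (o + o)` and its holder is at the address `D + 2 + (o + o)`. -/
noncomputable def auctionStep (N : ℕ) (A : ℕ → ℕ → Prop) (D i o : ℕ) (mem : ℕ → ℕ) : ℕ → ℕ :=
  if Bids N A (fun o => mem (D + 1 + (o + o))) (fun o => mem (D + 2 + (o + o))) i o then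
    Function.update (Function.update mem (D + 2 + (o + o)) (i + 1)) (D + 1 + (o + o))
      (mem (D + 1 + (o + o)) + 1)
  else mem

/-- One round of the auction. -/
noncomputable def auctionSweep (N : ℕ) (A : ℕ → ℕ → Prop) (D : ℕ) : (ℕ → ℕ) → ℕ → ℕ :=
  foldRange (fun i => foldRange (fun o => auctionStep N A D i o) N) N

/-- All prices become `0`, and nobody holds anything. -/
def auctionReset (N D : ℕ) : (ℕ → ℕ) → ℕ → ℕ :=
  foldRange (fun o mem =>
    Function.update (Function.update mem (D + 1 + (o + o)) 0) (D + 2 + (o + o)) 0) N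

/-- The auction: a reset and `N * (N + 1)` rounds. -/
noncomputable def auction (N : ℕ) (A : ℕ → ℕ → Prop) (D : ℕ) (mem : ℕ → ℕ) : ℕ → ℕ :=
  foldRange (fun _ m => auctionSweep N A D (foldRange (fun _ => auctionSweep N A D) N m)) N
    (auctionReset N D mem)

variable {N : ℕ} {A : ℕ → ℕ → Prop} {D : ℕ}

theorem auctionStep_fixed_or_lt {i o : ℕ} (ho : o < N) (mem : ℕ → ℕ) :
    (auctionStep N A D i o mem = mem) ∨
      ∑ x ∈ Finset.range N, mem (D + 1 + (x + x)) <
        ∑ x ∈ Finset.range N, auctionStep N A D i o mem (D + 1 + (x + x)) := by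
  unfold auctionStep
  split_ifs with hb
  · right
    refine Finset.sum_lt_sum (fun x _ => ?_) ⟨o, by simpa using ho, by simp⟩
    simp only [Function.update_apply]
    grind
  · exact .inl rfl

theorem auctionSweep_fixed_or_lt (mem : ℕ → ℕ) :
    (auctionSweep N A D mem = mem ∧
      ∀ i < N, ∀ o < N, ¬ Bids N A (fun o => mem (D + 1 + (o + o)))
        (fun o => mem (D + 2 + (o + o))) i o) ∨
      ∑ x ∈ Finset.range N, mem (D + 1 + (x + x)) <
        ∑ x ∈ Finset.range N, auctionSweep N A D mem (D + 1 + (x + x)) := by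
  have inner : ∀ i, ∀ m : ℕ → ℕ, _ := fun i m => foldRange_fixed_or_lt
    (f := fun o => auctionStep N A D i o) (m := N)
    (fun m => ∑ x ∈ Finset.range N, m (D + 1 + (x + x)))
    (fun o ho m => auctionStep_fixed_or_lt ho m) m
  rcases foldRange_fixed_or_lt (f := fun i => foldRange (fun o => auctionStep N A D i o) N)
    (m := N) (fun m => ∑ x ∈ Finset.range N, m (D + 1 + (x + x)))
    (fun i _ m => (inner i m).imp_left And.left) mem with ⟨h1, h2⟩ | h
  · refine .inl ⟨h1, fun i hi o ho hb => ?_⟩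
    rcases inner i mem with ⟨-, h4⟩ | h3
    · have := congrFun (h4 o ho) (D + 1 + (o + o))
      simp only [auctionStep] at this
      rw [if_pos hb] at this
      simp at this
    · rw [h2 i hi] at h3
      exact lt_irrefl _ h3
  · exact .inr h

/-- What remains true of the memory in an auction started in `mem₀`. -/
structure AuctionMemInv (N : ℕ) (A : ℕ → ℕ → Prop) (D : ℕ) (mem₀ mem : ℕ → ℕ) : Prop where
  eq_of_le : ∀ a ≤ D, mem a = mem₀ a
  inv : AuctionInv N A (fun o => mem (D + 1 + (o + o))) (fun o => mem (D + 2 + (o + o)))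
  le : HasMatching N A → ∀ o < N, mem (D + 1 + (o + o)) ≤ N

theorem AuctionMemInv.step {mem₀ mem : ℕ → ℕ} (h : AuctionMemInv N A D mem₀ mem) {i o : ℕ}
    (hi : i < N) : AuctionMemInv N A D mem₀ (auctionStep N A D i o mem) := by
  unfold auctionStep
  split_ifs with hb
  · have hp : (fun x => Function.update (Function.update mem (D + 2 + (o + o)) (i + 1))
        (D + 1 + (o + o)) (mem (D + 1 + (o + o)) + 1) (D + 1 + (x + x))) =
        Function.update (fun x => mem (D + 1 + (x + x))) o (mem (D + 1 + (o + o)) + 1) := by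
      funext x; simp only [Function.update_apply]; grind
    have hh : (fun x => Function.update (Function.update mem (D + 2 + (o + o)) (i + 1))
        (D + 1 + (o + o)) (mem (D + 1 + (o + o)) + 1) (D + 2 + (x + x))) =
        Function.update (fun x => mem (D + 2 + (x + x))) o (i + 1) := by
      funext x; simp only [Function.update_apply]; grind
    refine ⟨fun a ha => ?_, ?_, fun hM x hx => ?_⟩
    · rw [Function.update_of_ne (by omega), Function.update_of_ne (by omega), h.eq_of_le a ha]
    · rw [hp, hh]
      exact h.inv.bid hi hb
    · have h1 := h.inv.price_lt hM hi hb
      have h2 := h.le hM x hx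
      rw [congrFun hp x, Function.update_apply]
      split_ifs <;> omega
  · exact h

theorem AuctionMemInv.sweep {mem₀ mem : ℕ → ℕ} (h : AuctionMemInv N A D mem₀ mem) :
    AuctionMemInv N A D mem₀ (auctionSweep N A D mem) :=
  foldRange_induction (AuctionMemInv N A D mem₀)
    (fun _ hi _ h => foldRange_induction (AuctionMemInv N A D mem₀)
      (fun _ _ _ h => h.step hi) h) h

theorem auctionMemInv_reset (mem : ℕ → ℕ) :
    AuctionMemInv N A D mem (auctionReset N D mem) := by
  have key : ∀ m, (∀ a ≤ D, foldRange (fun o mem => Function.update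
      (Function.update mem (D + 1 + (o + o)) 0) (D + 2 + (o + o)) 0) m mem a = mem a) ∧
      ∀ o < m, foldRange (fun o mem => Function.update
        (Function.update mem (D + 1 + (o + o)) 0) (D + 2 + (o + o)) 0) m mem
          (D + 1 + (o + o)) = 0 ∧
        foldRange (fun o mem => Function.update
        (Function.update mem (D + 1 + (o + o)) 0) (D + 2 + (o + o)) 0) m mem
          (D + 2 + (o + o)) = 0 := by
    intro m
    induction m with
    | zero => exact ⟨fun a _ => rfl, by simp⟩
    | succ m ih =>
      refine ⟨fun a ha => ?_, fun o ho => ?_⟩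
      · rw [foldRange, Function.update_of_ne (by omega), Function.update_of_ne (by omega),
          ih.1 a ha]
      · have := ih.2 o
        simp only [foldRange, Function.update_apply]
        grind
  obtain ⟨h1, h2⟩ := key N
  exact ⟨h1, ⟨fun o ho _ _ _ h => (h (h2 o ho).2).elim,
    fun o ho i h => by have := (h2 o ho).2; unfold auctionReset at h; omega,
    fun o ho _ => (h2 o ho).1⟩, fun _ o ho => (h2 o ho).1.trans_le N.zero_le⟩

/-- The auction finds a perfect matching if there is one, and it leaves the memory up to the address
`D` unchanged. -/
theorem auction_spec (N : ℕ) (A : ℕ → ℕ → Prop) (D : ℕ) (mem : ℕ → ℕ) :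
    (∀ a ≤ D, auction N A D mem a = mem a) ∧
      ((∀ i < N, ∃ o < N, auction N A D mem (D + 2 + (o + o)) = i + 1) ↔ HasMatching N A) := by
  have hinv : AuctionMemInv N A D mem (auction N A D mem) :=
    foldRange_induction (AuctionMemInv N A D mem)
      (fun _ _ _ h => (foldRange_induction (AuctionMemInv N A D mem)
        (fun _ _ _ h => h.sweep) h).sweep) (auctionMemInv_reset mem)
  refine ⟨hinv.eq_of_le, hinv.inv.hasMatching, fun hM => ?_⟩
  let P : (ℕ → ℕ) → ℕ := fun m => ∑ x ∈ Finset.range N, m (D + 1 + (x + x))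
  let Q : (ℕ → ℕ) → Prop := fun m => auctionSweep N A D m = m
  have hg1 : ∀ m, Q (auctionSweep N A D m) ∨ P m + 1 ≤ P (auctionSweep N A D m) := by
    intro m
    rcases auctionSweep_fixed_or_lt (N := N) (A := A) (D := D) m with h | h
    · left; simp only [Q, h.1]
    · exact .inr h
  have hin := foldRange_const_fixed_or_le P Q (fun _ h => h) hg1 N
  -- The potential `P` is the sum of the prices. One pass of the outer loop makes `N + 1` sweeps,
  -- each raising `P` unless the auction is stationary.
  have hg2 : ∀ m, Q (auctionSweep N A D (foldRange (fun _ => auctionSweep N A D) N m)) ∨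
      P m + (N + 1) ≤ P (auctionSweep N A D (foldRange (fun _ => auctionSweep N A D) N m)) := by
    intro m
    rcases hin m with h | h
    · left; rw [h]; exact h
    · rcases hg1 (foldRange (fun _ => auctionSweep N A D) N m) with h' | h'
      · exact .inl h'
      · right; omega
  have hfixin : ∀ m, Q m → foldRange (fun _ => auctionSweep N A D) N m = m := fun m hm =>
    foldRange_induction (fun m' => m' = m) (fun _ _ _ h => by rw [h]; exact hm) rfl
  have hout := foldRange_const_fixed_or_le P Q
    (g := fun m => auctionSweep N A D (foldRange (fun _ => auctionSweep N A D) N m))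
    (fun m hm => by rw [hfixin m hm]; exact hm) hg2 N (auctionReset N D mem)
  intro i hi
  -- Otherwise the prices would sum to at least `N * (N + 1)`, whereas `N` prices of at most `N` sum
  -- to at most `N * N`.
  have hfix : Q (auction N A D mem) := by
    refine hout.resolve_right fun h => ?_
    have h1 : P (auction N A D mem) ≤ N * N := by
      simpa using Finset.sum_le_card_nsmul (Finset.range N) _ N
        fun o ho => hinv.le hM o (Finset.mem_range.mp ho)
    have h2 : P (auctionReset N D mem) + N * (N + 1) ≤ P (auction N A D mem) := h
    rw [mul_add] at h2
    omega
  rcases auctionSweep_fixed_or_lt (N := N) (A := A) (D := D) (auction N A D mem) with h | h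
  · exact exists_holds_of_not_bids hM h.2 i hi
  · rw [hfix] at h
    exact (lt_irrefl _ h).elim

end Memory

/-! ## The program -/

/-- Program and specification agree only on memories whose input part is intact, so agreement and
this invariant are carried through a loop together. -/
theorem foldRange_congr_of_inv {α : Type*} (I : α → Prop) {f g : ℕ → α → α} {m : ℕ}
    (h : ∀ v < m, ∀ a, I a → f v a = g v a ∧ I (g v a)) {a : α} (ha : I a) :
    foldRange f m a = foldRange g m a ∧ I (foldRange g m a) := by
  induction m with
  | zero => exact ⟨rfl, ha⟩
  | succ m ih =>
    obtain ⟨h1, h2⟩ := ih fun v hv => h v (hv.trans m.lt_succ_self)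
    rw [foldRange, foldRange, h1]
    exact h m m.lt_succ_self _ h2

/-! ### Formulas of the loop language about the encoded instance. -/

namespace LoopExpr

/-- An expression, as a formula, holds if its value is `0`. -/
def Holds (N : ℕ) (mem : ℕ → ℕ) (e : LoopExpr) (env : ℕ → ℕ) : Prop := e.eval N mem env = 0

/-- The formula `a ≤ b`. -/
def le (a b : LoopExpr) : LoopExpr := sub a b

/-- The formula `a < b`. -/
def lt (a b : LoopExpr) : LoopExpr := sub (add a (const 1)) b

/-- The formula `a = b`. -/
def eq (a b : LoopExpr) : LoopExpr := add (sub a b) (sub b a)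

/-- Negation. -/
def neg (a : LoopExpr) : LoopExpr := sub (const 1) a

/-- Implication. -/
def imp (a b : LoopExpr) : LoopExpr := neg (add a (neg b))

/-- Existential quantification over the numbers below the size. Universal quantification is
`LoopExpr.sum`, and conjunction is `LoopExpr.add`. -/
def ex (x : ℕ) (a : LoopExpr) : LoopExpr := neg (sum x (neg a))

/-- The conjunction of `f 0`, …, `f (m - 1)`. -/
def andRange (f : ℕ → LoopExpr) : ℕ → LoopExpr
  | 0 => const 0
  | m + 1 => add (andRange f m) (f m)

/-- The size times a variable other than `9`. -/
def scale (x : ℕ) : LoopExpr := sum 9 (var x)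

/-- The square of the size. -/
def sq : LoopExpr := sum 9 size

section

variable {N : ℕ} {mem env : ℕ → ℕ} {a b : LoopExpr} {x : ℕ}

theorem holds_le : (le a b).Holds N mem env ↔ a.eval N mem env ≤ b.eval N mem env := by
  simp [Holds, le, eval, Nat.sub_eq_zero_iff_le]

theorem holds_lt : (lt a b).Holds N mem env ↔ a.eval N mem env < b.eval N mem env := by
  simp [Holds, lt, eval, Nat.sub_eq_zero_iff_le]

theorem holds_eq : (eq a b).Holds N mem env ↔ a.eval N mem env = b.eval N mem env := by
  simp only [Holds, eq, eval]; omega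

theorem holds_neg : (neg a).Holds N mem env ↔ ¬ a.Holds N mem env := by
  simp only [Holds, neg, eval]; omega

theorem holds_add : (add a b).Holds N mem env ↔ a.Holds N mem env ∧ b.Holds N mem env := by
  simp [Holds, eval]

theorem holds_imp : (imp a b).Holds N mem env ↔ (a.Holds N mem env → b.Holds N mem env) := by
  simp only [imp, holds_neg, holds_add]; tauto

theorem holds_sum : (sum x a).Holds N mem env ↔
    ∀ v < N, a.Holds N mem (Function.update env x v) := by
  simp [Holds, eval, Finset.sum_eq_zero_iff]

theorem holds_ex : (ex x a).Holds N mem env ↔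
    ∃ v < N, a.Holds N mem (Function.update env x v) := by
  simp only [ex, holds_neg, holds_sum]; push Not; rfl

theorem holds_andRange {f : ℕ → LoopExpr} {m : ℕ} : (andRange f m).Holds N mem env ↔
    ∀ j < m, (f j).Holds N mem env := by
  induction m with
  | zero => simp [andRange, Holds, eval]
  | succ m ih => rw [andRange, holds_add, ih, Nat.forall_lt_succ_right]

theorem eval_scale (hx : x ≠ 9) : (scale x).eval N mem env = N * env x := by
  simp [scale, eval, hx]

theorem eval_sq : sq.eval N mem env = N * N := by
  simp [sq, eval]

end

/-- The object in position `r` of the list of agent `y`. -/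
def prefEntry (y r : ℕ) : LoopExpr := load (add (const 1) (add (scale y) (var r)))

/-- Agent `y` strictly prefers the object `a` to the object `b`. -/
def strict (y a b : ℕ) : LoopExpr :=
  ex 3 (ex 4 (add (lt (var 3) (var 4))
    (add (eq (prefEntry y 3) (var a)) (eq (prefEntry y 4) (var b)))))

/-- Agent `y` receives the object `x` with positive probability. -/
def support (y x : ℕ) : LoopExpr :=
  lt (const 0) (load (add (add (const 1) sq)
    (add (add (scale y) (var x)) (add (scale y) (var x)))))

/-- The pair of the agent `y` and the object `x` is in the support, and if it meets one of the `K`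
pairs in the variables `10 + j` and `10 + K + j` then it is that pair. -/
def acceptable (K y x : ℕ) : LoopExpr :=
  add (support y x) (andRange (fun j =>
    add (imp (eq (var y) (var (10 + j))) (eq (var x) (var (10 + K + j))))
      (imp (eq (var x) (var (10 + K + j))) (eq (var y) (var (10 + j))))) K)

/-- The `K` pairs in the variables `10 + j` and `10 + K + j` form a closed walk along which each
agent strictly prefers the next object to his own. -/
def closedWalk (K : ℕ) : LoopExpr :=
  andRange (fun j => strict (10 + j) (10 + K + (j + 1) % K) (10 + K + j)) K

/-- The address of the result. -/
def resultAddr : LoopExpr := add (const 1) (add (add sq sq) sq)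

/-- The address of the price of the object `x`. -/
def priceAddr (x : ℕ) : LoopExpr := add (add resultAddr (const 1)) (add (var x) (var x))

/-- The address of the holder of the object `x`. -/
def holderAddr (x : ℕ) : LoopExpr := add (add resultAddr (const 2)) (add (var x) (var x))

end LoopExpr

/-- The address of the first memory cell behind an input with `N` agents. -/
def endAddr (N : ℕ) : ℕ := 1 + (N * N + N * N + N * N)

/-- The address of the numerator of the entry `(i, o)` of the random assignment. -/
def entryAddr (N i o : ℕ) : ℕ := 1 + N * N + ((N * i + o) + (N * i + o))

/-- Agent `y` strictly prefers `a` to `b`, according to the input in the memory. -/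
def MemStrict (N : ℕ) (mem : ℕ → ℕ) (y a b : ℕ) : Prop :=
  ∃ r < N, ∃ s < N, r < s ∧ mem (1 + (N * y + r)) = a ∧ mem (1 + (N * y + s)) = b

/-- The pair `(i, o)` is in the support of the random assignment in the memory, and if it meets one
of the `K` pairs in the environment then it is that pair. -/
def MemAcceptable (N K : ℕ) (mem env : ℕ → ℕ) (i o : ℕ) : Prop :=
  0 < mem (entryAddr N i o) ∧ ∀ j < K, i = env (10 + j) ↔ o = env (10 + K + j)

/-- The `K` pairs in the environment form a closed walk of improvements. -/
def MemClosedWalk (N K : ℕ) (mem env : ℕ → ℕ) : Prop :=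
  ∀ j < K, MemStrict N mem (env (10 + j)) (env (10 + K + (j + 1) % K)) (env (10 + K + j))

theorem entryAddr_lt {N i o : ℕ} (hi : i < N) (ho : o < N) : entryAddr N i o < endAddr N := by
  unfold entryAddr endAddr
  have : N * (i + 1) ≤ N * N := Nat.mul_le_mul_left _ hi
  rw [mul_add] at this
  omega

theorem prefAddr_lt {N y r : ℕ} (hy : y < N) (hr : r < N) : 1 + (N * y + r) < endAddr N := by
  unfold endAddr
  have : N * (y + 1) ≤ N * N := Nat.mul_le_mul_left _ hy
  rw [mul_add] at this
  omega

/-- Variables below `10` are reserved for the auction and for bound variables of formulas; the walk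
occupies those from `10` on. -/
theorem memAcceptable_update {N K : ℕ} {mem env : ℕ → ℕ} {x v : ℕ} (hx : x < 10) :
    MemAcceptable N K mem (Function.update env x v) = MemAcceptable N K mem env := by
  funext i o
  have h : ∀ y, 10 ≤ y → Function.update env x v y = env y := fun y hy =>
    Function.update_of_ne (by omega) _ _
  simp only [MemAcceptable]
  refine propext (and_congr Iff.rfl (forall₂_congr fun j _ => ?_))
  rw [h _ (by omega), h _ (by omega)]

namespace LoopExpr

variable {N K : ℕ} {mem env : ℕ → ℕ}

theorem holds_strict {y a b : ℕ} (hy : 9 < y) (ha : 9 < a) (hb : 9 < b) :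
    (strict y a b).Holds N mem env ↔ MemStrict N mem (env y) (env a) (env b) := by
  have e1 : ∀ r s : ℕ, ∀ z, 9 < z →
      Function.update (Function.update env 3 r) 4 s z = env z := fun r s z hz => by
    rw [Function.update_of_ne (by omega), Function.update_of_ne (by omega)]
  simp only [strict, prefEntry, holds_ex, holds_add, holds_lt, holds_eq, eval,
    eval_scale hy.ne', MemStrict, e1 _ _ _ hy, e1 _ _ _ ha, e1 _ _ _ hb]
  simp

theorem holds_acceptable {y x : ℕ} (hy : y ≠ 9) :
    (acceptable K y x).Holds N mem env ↔ MemAcceptable N K mem env (env y) (env x) := by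
  simp only [acceptable, support, holds_add, holds_lt, holds_andRange, holds_imp, holds_eq, eval,
    eval_scale hy, eval_sq, MemAcceptable, entryAddr, iff_iff_implies_and_implies]

theorem holds_closedWalk : (closedWalk K).Holds N mem env ↔ MemClosedWalk N K mem env := by
  rw [closedWalk, holds_andRange]
  exact forall₂_congr fun j _ => holds_strict (by omega) (by omega) (by omega)

theorem eval_resultAddr : resultAddr.eval N mem env = endAddr N := by
  simp [resultAddr, eval, eval_sq, endAddr]

theorem eval_priceAddr {x : ℕ} :
    (priceAddr x).eval N mem env = endAddr N + 1 + (env x + env x) := by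
  simp [priceAddr, eval, eval_resultAddr]

theorem eval_holderAddr {x : ℕ} :
    (holderAddr x).eval N mem env = endAddr N + 2 + (env x + env x) := by
  simp [holderAddr, eval, eval_resultAddr]

end LoopExpr

/-! ### The robustness test and its effect on the memory. -/

namespace LoopStmt

open LoopExpr

/-- Agent `0` takes the object `1` if he bids for it. -/
def bidStep (K : ℕ) : LoopStmt :=
  guard (add (sum 2 (neg (eq (load (holderAddr 2)) (add (var 0) (const 1)))))
    (add (acceptable K 0 1)
      (sum 2 (imp (acceptable K 0 2) (le (load (priceAddr 1)) (load (priceAddr 2)))))))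
  (seq (store (holderAddr 1) (add (var 0) (const 1)))
    (store (priceAddr 1) (add (load (priceAddr 1)) (const 1))))

/-- One round of the auction. -/
def sweep (K : ℕ) : LoopStmt := forRange 0 (forRange 1 (bidStep K))

/-- The auction. -/
def matching (K : ℕ) : LoopStmt :=
  seq (forRange 0 (seq (store (priceAddr 0) (const 0)) (store (holderAddr 0) (const 0))))
    (forRange 5 (seq (forRange 6 (sweep K)) (sweep K)))

/-- Set the result to `0` if the pairs in the variables form a closed walk of improvements that
extends to an assignment in the support. -/
def check (K : ℕ) : LoopStmt :=
  guard (closedWalk K) (seq (matching K)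
    (guard (sum 0 (ex 1 (eq (load (holderAddr 1)) (add (var 0) (const 1)))))
      (store resultAddr (const 0))))

/-- Run a statement for all values of the variables `10`, …, `10 + m - 1`. -/
def nest (b : LoopStmt) : ℕ → LoopStmt
  | 0 => b
  | m + 1 => forRange (10 + m) (nest b m)

/-- The test of all closed walks of length `K`. -/
def robustnessTest (K : ℕ) : LoopStmt :=
  seq (store resultAddr (const 1)) (nest (check K) (2 * K))

variable {N K : ℕ} {mem₀ mem env : ℕ → ℕ}

theorem memAcceptable_congr (h : ∀ a < endAddr N, mem a = mem₀ a) {i o : ℕ} (hi : i < N)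
    (ho : o < N) : MemAcceptable N K mem env i o ↔ MemAcceptable N K mem₀ env i o := by
  rw [MemAcceptable, MemAcceptable, h _ (entryAddr_lt hi ho)]

theorem memClosedWalk_congr (h : ∀ a < endAddr N, mem a = mem₀ a)
    (henv : ∀ j < K, env (10 + j) < N) :
    MemClosedWalk N K mem env ↔ MemClosedWalk N K mem₀ env := by
  refine forall₂_congr fun j hj => ?_
  unfold MemStrict
  refine exists_congr fun r => and_congr_right fun hr => exists_congr fun s =>
    and_congr_right fun hs => ?_
  rw [h _ (prefAddr_lt (henv j hj) hr), h _ (prefAddr_lt (henv j hj) hs)]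

/-- Acceptability reads only the input, so the relation can be fixed by `mem₀` while prices and
holders change in `mem`. -/
theorem exec_bidStep (h : ∀ a < endAddr N, mem a = mem₀ a) (h0 : env 0 < N) (h1 : env 1 < N) :
    (bidStep K).exec N env mem =
      auctionStep N (MemAcceptable N K mem₀ env) (endAddr N) (env 0) (env 1) mem := by
  have hiff : (add (sum 2 (neg (eq (load (holderAddr 2)) (add (var 0) (const 1)))))
      (add (acceptable K 0 1) (sum 2 (imp (acceptable K 0 2)
        (le (load (priceAddr 1)) (load (priceAddr 2))))))).eval N mem env = 0 ↔
      Bids N (MemAcceptable N K mem₀ env) (fun o => mem (endAddr N + 1 + (o + o)))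
        (fun o => mem (endAddr N + 2 + (o + o))) (env 0) (env 1) := by
    change Holds _ _ _ _ ↔ _
    simp only [holds_add, holds_sum, holds_neg, holds_eq, holds_imp, holds_le, eval,
      eval_holderAddr, eval_priceAddr, holds_acceptable (show (0 : ℕ) ≠ 9 by decide),
      memAcceptable_update (show 2 < 10 by decide), Bids]
    refine and_congr (by simp) (and_congr (memAcceptable_congr h h0 h1)
      (forall₂_congr fun v hv => ?_))
    simp [memAcceptable_congr h h0 hv]
  rw [bidStep, exec, auctionStep]
  by_cases hb : Bids N (MemAcceptable N K mem₀ env) (fun o => mem (endAddr N + 1 + (o + o)))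
      (fun o => mem (endAddr N + 2 + (o + o))) (env 0) (env 1)
  · rw [if_pos (hiff.mpr hb), if_pos hb]
    simp [exec, eval, eval_holderAddr, eval_priceAddr]
  · rw [if_neg (mt hiff.mp hb), if_neg hb]

theorem auctionStep_of_lt {A : ℕ → ℕ → Prop} {D i o a : ℕ} (ha : a ≤ D) :
    auctionStep N A D i o mem a = mem a := by
  unfold auctionStep
  split_ifs
  · rw [Function.update_of_ne (by omega), Function.update_of_ne (by omega)]
  · rfl

theorem exec_sweep (h : ∀ a < endAddr N, mem a = mem₀ a) :
    (sweep K).exec N env mem = auctionSweep N (MemAcceptable N K mem₀ env) (endAddr N) mem ∧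
      ∀ a < endAddr N,
        auctionSweep N (MemAcceptable N K mem₀ env) (endAddr N) mem a = mem₀ a := by
  refine foldRange_congr_of_inv (fun mem : ℕ → ℕ => ∀ a < endAddr N, mem a = mem₀ a)
    (fun i hi mem h => foldRange_congr_of_inv (fun mem : ℕ → ℕ => ∀ a < endAddr N, mem a = mem₀ a)
      (fun o ho mem h => ⟨?_, fun a ha => ?_⟩) h) h
  · rw [exec_bidStep h (by simpa using hi) (by simpa using ho),
      memAcceptable_update (by decide), memAcceptable_update (by decide)]
    simp
  · rw [auctionStep_of_lt ha.le, h a ha]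

theorem exec_matching (h : ∀ a < endAddr N, mem a = mem₀ a) :
    (matching K).exec N env mem = auction N (MemAcceptable N K mem₀ env) (endAddr N) mem := by
  have hreset : (forRange 0 (seq (store (priceAddr 0) (const 0))
      (store (holderAddr 0) (const 0)))).exec N env mem = auctionReset N (endAddr N) mem := by
    simp only [exec, eval_priceAddr, eval_holderAddr, eval, auctionReset, Function.update_self]
  rw [matching, exec, hreset]
  refine (foldRange_congr_of_inv (fun mem : ℕ → ℕ => ∀ a < endAddr N, mem a = mem₀ a)
    (fun u _ mem h => ?_) fun a ha => ?_).1
  · have hin := foldRange_congr_of_inv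
      (f := fun v => (sweep K).exec N (Function.update (Function.update env 5 u) 6 v))
      (g := fun _ => auctionSweep N (MemAcceptable N K mem₀ env) (endAddr N)) (m := N)
      (fun mem : ℕ → ℕ => ∀ a < endAddr N, mem a = mem₀ a)
      (fun v _ mem h => by
        have := exec_sweep (K := K) (env := Function.update (Function.update env 5 u) 6 v) h
        rwa [memAcceptable_update (by decide), memAcceptable_update (by decide)] at this) h
    have := exec_sweep (K := K) (env := Function.update env 5 u) hin.2
    rw [memAcceptable_update (by decide)] at this
    rw [exec, exec, hin.1]
    exact this
  -- The reset does not involve the relation, so any one serves here.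
  · rw [(auctionMemInv_reset (A := fun _ _ => False) mem).eq_of_le a ha.le, h a ha]

/-- For environments satisfying `E`, the statement keeps the input, and it sets the result to `0`
if `φ` holds and keeps it otherwise. -/
def Refutes (N : ℕ) (mem₀ : ℕ → ℕ) (b : LoopStmt) (E φ : (ℕ → ℕ) → Prop) : Prop :=
  ∀ env mem : ℕ → ℕ, E env → (∀ a < endAddr N, mem a = mem₀ a) →
    (∀ a < endAddr N, b.exec N env mem a = mem₀ a) ∧
    (φ env → b.exec N env mem (endAddr N) = 0) ∧
    (¬ φ env → b.exec N env mem (endAddr N) = mem (endAddr N))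

/-- The agents of the walk must be in range for their preference lists to be read inside the input,
which the auction does not overwrite. -/
theorem refutes_check (N K : ℕ) (mem₀ : ℕ → ℕ) :
    Refutes N mem₀ (check K) (fun env => ∀ j < K, env (10 + j) < N) fun env =>
      MemClosedWalk N K mem₀ env ∧ HasMatching N (MemAcceptable N K mem₀ env) := by
  intro env mem henv h
  have hwalk : (closedWalk K).eval N mem env = 0 ↔ MemClosedWalk N K mem₀ env :=
    holds_closedWalk.trans (memClosedWalk_congr h henv)
  simp only [check, exec]
  by_cases hw : MemClosedWalk N K mem₀ env
  · obtain ⟨h1, h2⟩ := auction_spec N (MemAcceptable N K mem₀ env) (endAddr N) mem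
    have hsucc : (sum 0 (ex 1 (eq (load (holderAddr 1)) (add (var 0) (const 1))))).eval N
        (auction N (MemAcceptable N K mem₀ env) (endAddr N) mem) env = 0 ↔
        HasMatching N (MemAcceptable N K mem₀ env) := by
      rw [← h2]
      change Holds _ _ _ _ ↔ _
      simp [holds_sum, holds_ex, holds_eq, eval, eval_holderAddr]
    rw [if_pos (hwalk.mpr hw), exec_matching h]
    -- `eval.eq_3` is the equation of `eval` for `const`; the success test has to stay folded for
    -- `hsucc`.
    simp only [hw, true_and, eval_resultAddr, eval.eq_3]
    by_cases hM : HasMatching N (MemAcceptable N K mem₀ env)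
    · rw [if_pos (hsucc.mpr hM)]
      refine ⟨fun a ha => ?_, fun _ => by simp, fun h => (h hM).elim⟩
      rw [Function.update_of_ne ha.ne, h1 a ha.le, h a ha]
    · rw [if_neg (mt hsucc.mp hM)]
      exact ⟨fun a ha => (h1 a ha.le).trans (h a ha), fun h => (hM h).elim, fun _ => h1 _ le_rfl⟩
  · rw [if_neg (mt hwalk.mp hw)]
    exact ⟨h, fun h => (hw h.1).elim, fun _ => rfl⟩

/-- A result of `0` is never undone by later rounds, so a loop computes an existential quantifier.
-/
theorem Refutes.forRange {b : LoopStmt} {E E' φ : (ℕ → ℕ) → Prop} (hb : Refutes N mem₀ b E φ)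
    {x : ℕ} (hE : ∀ env, E' env → ∀ v < N, E (Function.update env x v)) :
    Refutes N mem₀ (forRange x b) E' fun env => ∃ v < N, φ (Function.update env x v) := by
  intro env mem henv h
  have key : ∀ m ≤ N, (∀ a < endAddr N,
      foldRange (fun v => b.exec N (Function.update env x v)) m mem a = mem₀ a) ∧
      ((∃ v < m, φ (Function.update env x v)) →
        foldRange (fun v => b.exec N (Function.update env x v)) m mem (endAddr N) = 0) ∧
      ((¬ ∃ v < m, φ (Function.update env x v)) →
        foldRange (fun v => b.exec N (Function.update env x v)) m mem (endAddr N) =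
          mem (endAddr N)) := by
    intro m
    induction m with
    | zero => exact fun _ => ⟨h, by simp, fun _ => rfl⟩
    | succ m ih =>
      intro hm
      obtain ⟨i1, i2, i3⟩ := ih (by omega)
      obtain ⟨k1, k2, k3⟩ := hb (Function.update env x m) _ (hE env henv m hm) i1
      refine ⟨k1, ?_, fun hno => ?_⟩
      · rintro ⟨v, hv, hφ⟩
        by_cases hm' : φ (Function.update env x m)
        · exact k2 hm'
        · rw [foldRange, k3 hm']
          refine i2 ⟨v, ?_, hφ⟩
          rcases Nat.lt_succ_iff_lt_or_eq.mp hv with hv | rfl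
          exacts [hv, (hm' hφ).elim]
      · rw [foldRange, k3 fun h => hno ⟨m, by omega, h⟩,
          i3 fun ⟨v, hv, hφ⟩ => hno ⟨v, by omega, hφ⟩]
  exact key N le_rfl

theorem Refutes.congr {b : LoopStmt} {E φ ψ : (ℕ → ℕ) → Prop} (hb : Refutes N mem₀ b E φ)
    (h : ∀ env, φ env ↔ ψ env) : Refutes N mem₀ b E ψ := by
  rwa [show ψ = φ from funext fun env => propext (h env).symm]

/-- The first `m` variables are supplied by the loops, so only the others still have to be assumed
in range. -/
theorem Refutes.nest {b : LoopStmt} {φ : (ℕ → ℕ) → Prop} {M : ℕ}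
    (hb : Refutes N mem₀ b (fun env => ∀ j < M, env (10 + j) < N) φ) (m : ℕ) :
    Refutes N mem₀ (nest b m) (fun env => ∀ j < M, m ≤ j → env (10 + j) < N) fun env =>
      ∃ env' : ℕ → ℕ, (∀ j < m, env' (10 + j) < N) ∧
        (∀ x, x < 10 ∨ 10 + m ≤ x → env' x = env x) ∧ φ env' := by
  induction m with
  | zero =>
    have h : Refutes N mem₀ (LoopStmt.nest b 0)
        (fun env => ∀ j < M, 0 ≤ j → env (10 + j) < N) φ := by simpa [LoopStmt.nest] using hb
    refine h.congr fun env => ⟨fun h => ⟨env, by simp, fun _ _ => rfl, h⟩, ?_⟩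
    rintro ⟨env', -, h1, h2⟩
    rwa [show env = env' from funext fun x => (h1 x (by omega)).symm]
  | succ m ih =>
    refine (ih.forRange (x := 10 + m) fun env henv v hv j hj hmj => ?_).congr fun env => ?_
    · rw [Function.update_apply]
      split_ifs with h
      · exact hv
      · exact henv j hj (by omega)
    · constructor
      · rintro ⟨v, hv, env', h1, h2, h3⟩
        refine ⟨env', fun j hj => ?_, fun x hx => ?_, h3⟩
        · rcases Nat.lt_succ_iff_lt_or_eq.mp hj with hj | rfl
          · exact h1 j hj
          · rw [h2 _ (by omega), Function.update_self]; exact hv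
        · rw [h2 x (by omega), Function.update_of_ne (by omega)]
      · rintro ⟨env', h1, h2, h3⟩
        refine ⟨env' (10 + m), h1 m (by omega), env', fun j hj => h1 j (by omega),
          fun x hx => ?_, h3⟩
        rw [Function.update_apply]
        split_ifs with hxm
        · rw [hxm]
        · exact h2 x (by omega)

theorem exec_robustnessTest (N K : ℕ) (mem env : ℕ → ℕ) :
    ((∃ env : ℕ → ℕ, (∀ j < 2 * K, env (10 + j) < N) ∧ MemClosedWalk N K mem env ∧
        HasMatching N (MemAcceptable N K mem env)) →
      (robustnessTest K).exec N env mem (endAddr N) = 0) ∧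
    ((¬ ∃ env : ℕ → ℕ, (∀ j < 2 * K, env (10 + j) < N) ∧ MemClosedWalk N K mem env ∧
        HasMatching N (MemAcceptable N K mem env)) →
      (robustnessTest K).exec N env mem (endAddr N) = 1) := by
  have h := (refutes_check N K mem).nest (2 * K) env
    (Function.update mem (endAddr N) 1) (fun j _ _ => by omega)
    fun a ha => Function.update_of_ne ha.ne _ _
  simp only [robustnessTest, exec, eval_resultAddr, eval]
  have hiff : (∃ env' : ℕ → ℕ, (∀ j < 2 * K, env' (10 + j) < N) ∧ MemClosedWalk N K mem env' ∧
        HasMatching N (MemAcceptable N K mem env')) ↔ ∃ env' : ℕ → ℕ,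
      (∀ j < 2 * K, env' (10 + j) < N) ∧ (∀ x, x < 10 ∨ 10 + 2 * K ≤ x → env' x = env x) ∧
        MemClosedWalk N K mem env' ∧ HasMatching N (MemAcceptable N K mem env') := by
    refine ⟨?_, fun ⟨env', h1, _, h3⟩ => ⟨env', h1, h3⟩⟩
    rintro ⟨env', h1, h2, h3⟩
    -- The loops change only the `2 * K` variables of the walk, and the tested property depends on
    -- no others.
    let env'' : ℕ → ℕ := fun x => if x < 10 ∨ 10 + 2 * K ≤ x then env x else env' x
    have he : ∀ j < 2 * K, env'' (10 + j) = env' (10 + j) := fun j hj => if_neg (by omega)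
    refine ⟨env'', fun j hj => by rw [he j hj]; exact h1 j hj, fun x hx => if_pos hx,
      fun j hj => ?_, ?_⟩
    · have hmod := Nat.mod_lt (j + 1) (show 0 < K by omega)
      have e1 := he (K + j) (by omega)
      have e2 := he (K + (j + 1) % K) (by omega)
      rw [← add_assoc] at e1 e2
      rw [he j (by omega), e1, e2]
      exact h2 j hj
    · have : MemAcceptable N K mem env'' = MemAcceptable N K mem env' := by
        funext i o
        refine propext (and_congr_right fun _ => forall₂_congr fun j hj => ?_)
        have e1 := he (K + j) (by omega)
        rw [← add_assoc] at e1
        rw [he j (by omega), e1]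
      rwa [this]
  rw [hiff]
  refine ⟨h.2.1, fun hno => (h.2.2 hno).trans (by simp)⟩

end LoopStmt

/-! ## The input -/

/-- Row-major addressing in a concatenation of blocks of equal length. -/
theorem List.getD_flatMap_of_length_eq {α : Type*} (f : α → List ℕ) (m : ℕ) (l : List α)
    (hf : ∀ x ∈ l, (f x).length = m) {i r : ℕ} (hi : i < l.length) (hr : r < m) :
    (l.flatMap f).getD (m * i + r) 0 = (f l[i]).getD r 0 := by
  induction l generalizing i with
  | nil => simp at hi
  | cons x l ih =>
    have hx : (f x).length = m := hf x (by simp)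
    rw [List.flatMap_cons]
    cases i with
    | zero => rw [List.getD_append _ _ _ _ (by simpa [hx] using hr)]; simp
    | succ i =>
      rw [List.getD_append_right _ _ _ _ (by rw [hx, mul_add]; omega), hx,
        show m * (i + 1) + r - m = m * i + r by rw [mul_add]; omega,
        ih (fun y hy => hf y (by simp [hy])) (by simpa using hi)]
      simp

namespace AssignmentInstance

variable (I : AssignmentInstance)

theorem encode_pref {i r : ℕ} (hi : i < I.n) (hr : r < I.n) :
    I.encode.getD (1 + (I.n * i + r)) 0 = I.pref ⟨i, hi⟩ ⟨r, hr⟩ := by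
  have hle : I.n * (i + 1) ≤ I.n * I.n := Nat.mul_le_mul_left _ hi
  rw [mul_add] at hle
  rw [encode, add_comm 1, List.cons_append, List.getD_cons_succ, List.getD_append _ _ _ _ (by
    simp [List.length_flatMap]; omega),
    List.getD_flatMap_of_length_eq _ I.n _ (by simp) (by simpa using hi) hr]
  simp [hr]

theorem encode_entry {i o : ℕ} (hi : i < I.n) (ho : o < I.n) :
    I.encode.getD (entryAddr I.n i o) 0 = (I.p ⟨i, hi⟩ ⟨o, ho⟩).num.natAbs := by
  rw [encode, entryAddr, add_comm 1, add_right_comm, List.cons_append, List.getD_cons_succ,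
    List.getD_append_right _ _ _ _ (by simp [List.length_flatMap])]
  simp only [List.length_flatMap, List.length_map, List.length_finRange, List.map_const',
    List.sum_replicate, smul_eq_mul, Nat.add_sub_cancel_left]
  -- A row is a block of length `2 * n`, an entry a block of length `2`, and the numerator has
  -- offset `0`.
  rw [show I.n * i + o + (I.n * i + o) = (2 * I.n) * i + (2 * o + 0) by ring,
    List.getD_flatMap_of_length_eq _ (2 * I.n) _ (by simp [List.length_flatMap, mul_comm])
      (by simpa using hi) (by omega),
    List.getD_flatMap_of_length_eq _ 2 _ (by simp) (by simpa using ho) (by omega)]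
  simp

theorem encode_size : I.encode.getD 0 0 = I.n := rfl

/-- Although `n` is written in binary, the preference lists contain `n * n` numbers, so loops up to
`n` are polynomial in the input size. -/
theorem size_le_inputSize : I.encode.getD 0 0 ≤ inputSize I.encode := by
  have h : ∀ l : List ℕ, l.length ≤ inputSize l := by
    intro l
    induction l with
    | nil => simp
    | cons x l ih => simp only [inputSize, List.map_cons, List.sum_cons, List.length_cons] at *; omega
  refine le_trans ?_ (h _)
  have : I.n ≤ I.n * I.n := Nat.le_mul_self _
  rw [encode_size, encode]
  simp only [List.length_append, List.length_cons, List.length_flatMap, List.length_map,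
    List.length_finRange, List.map_const', List.sum_replicate, smul_eq_mul]
  omega

theorem memStrict_iff {y a b : Fin I.n} :
    MemStrict I.n (fun x => I.encode.getD x 0) y a b ↔ I.pref.Strict y a b := by
  unfold MemStrict Profile.Strict
  constructor
  · rintro ⟨r, hr, s, hs, hrs, h1, h2⟩
    beta_reduce at h1 h2
    rw [I.encode_pref y.2 hr, Fin.val_inj] at h1
    rw [I.encode_pref y.2 hs, Fin.val_inj] at h2
    rw [← h1, ← h2]
    simpa using hrs
  · intro h
    refine ⟨(I.pref y).symm a, Fin.is_lt _, (I.pref y).symm b, Fin.is_lt _, h, ?_, ?_⟩ <;>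
      · beta_reduce
        rw [I.encode_pref y.2 (Fin.is_lt _)]
        simp

/-- Entries are nonnegative, so a nonzero numerator means a positive probability and denominators
need not be read. -/
theorem encode_entry_pos_iff {i o : Fin I.n} :
    0 < I.encode.getD (entryAddr I.n i o) 0 ↔ 0 < I.realMatrix i o := by
  rw [I.encode_entry i.2 o.2, realMatrix, Matrix.map_apply, Rat.cast_pos, Int.natAbs_pos]
  have h : 0 ≤ I.p i o := nonneg_of_mem_doublyStochastic I.p_mem
  rw [Ne, Rat.num_eq_zero]
  exact ⟨fun h' => lt_of_le_of_ne h (Ne.symm h'), fun h' => h'.ne'⟩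

theorem realMatrix_mem : I.realMatrix ∈ doublyStochastic ℝ (Fin I.n) := by
  obtain ⟨h1, h2, h3⟩ := mem_doublyStochastic_iff_sum.mp I.p_mem
  simp only [mem_doublyStochastic_iff_sum, realMatrix, Matrix.map_apply]
  exact ⟨fun i o => by exact_mod_cast h1 i o, fun i => by exact_mod_cast h2 i,
    fun o => by exact_mod_cast h3 o⟩

end AssignmentInstance

/-- With at most `k` agent types, the failure of robustness is witnessed by a closed envy walk of
length `k !`, because a short cycle has at most `k` agents. -/
theorem not_robustExPostEfficient_iff_exists_walk {n k : ℕ} {pref : Profile n}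
    {p : Matrix (Fin n) (Fin n) ℝ} (hp : p ∈ doublyStochastic ℝ (Fin n))
    (hk : pref.numTypes ≤ k) :
    ¬ RobustExPostEfficient pref p ↔
      ∃ (d : Equiv.Perm (Fin n)) (a : ℕ → Fin n), (∀ i, 0 < p i (d i)) ∧
        ∀ j < k.factorial, pref.Envies d (a j) (a ((j + 1) % k.factorial)) := by
  rw [not_robustExPostEfficient_iff hp]
  refine exists_congr fun d => ⟨fun ⟨hd, h⟩ => ?_, fun ⟨a, hd, h⟩ => ⟨hd, ?_⟩⟩
  · obtain ⟨m, w, h1, h2⟩ := Profile.not_paretoOptimal_iff.mp h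
    have hm : m + 1 ≤ k := by
      refine le_trans ?_ hk
      rw [← Fintype.card_fin (m + 1), ← Finset.card_univ]
      exact Finset.card_le_card_of_injOn (fun j => pref (w j)) (fun j _ => by simp)
        fun j _ l _ h => h2 j l h
    -- Divisibility lets the cycle be traversed a whole number of times in `k !` steps.
    have hdvd : m + 1 ∣ k.factorial := Nat.dvd_factorial m.succ_pos hm
    refine ⟨fun j => w (Fin.ofNat (m + 1) j), hd, fun j _ => ?_⟩
    have : Fin.ofNat (m + 1) ((j + 1) % k.factorial) = Fin.ofNat (m + 1) j + 1 := by
      ext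
      simp only [Fin.val_ofNat, Fin.val_add, Nat.mod_mod_of_dvd _ hdvd]
      simp [Nat.add_mod]
    simp only [this]
    exact h1 _
  · have hwalk : pref.IsEnvyWalk d (fun j => a (j % k.factorial)) k.factorial :=
      ⟨k.factorial_pos, fun j => by simp, fun j => by
        have := h (j % k.factorial) (Nat.mod_lt _ k.factorial_pos)
        rwa [Nat.mod_add_mod] at this⟩
    exact Profile.not_paretoOptimal_iff.mpr hwalk.exists_cycle

/-- A perfect matching of acceptable pairs is a permutation in the support that gives each agent of
the walk the object listed with him; the walk condition then says that these agents envy one another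
in turn. Repeated pairs in the walk do no harm. -/
theorem AssignmentInstance.exists_memClosedWalk_iff (I : AssignmentInstance) {k : ℕ}
    (hk : I.pref.numTypes ≤ k) :
    (∃ env : ℕ → ℕ, (∀ j < 2 * k.factorial, env (10 + j) < I.n) ∧
      MemClosedWalk I.n k.factorial (fun x => I.encode.getD x 0) env ∧
      HasMatching I.n (MemAcceptable I.n k.factorial (fun x => I.encode.getD x 0) env)) ↔
    ¬ RobustExPostEfficient I.pref I.realMatrix := by
  rw [not_robustExPostEfficient_iff_exists_walk I.realMatrix_mem hk]
  have hK := k.factorial_pos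
  set K := k.factorial
  constructor
  · rintro ⟨env, henv, hw, g, hg, hinj⟩
    let d : Fin I.n → Fin I.n := fun i => ⟨g i, (hg i i.2).1⟩
    have hd : Function.Bijective d := Finite.injective_iff_bijective.mp fun i j h =>
      Fin.ext (hinj i.2 j.2 (congrArg Fin.val h))
    let a : ℕ → Fin I.n := fun j => ⟨env (10 + j % K), henv _ (by
      have := Nat.mod_lt j hK; omega)⟩
    have ha : ∀ j < K, (a j : ℕ) = env (10 + j) := fun j hj => by simp [a, Nat.mod_eq_of_lt hj]
    have hda : ∀ j < K, (d (a j) : ℕ) = env (10 + K + j) := fun j hj =>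
      ((hg _ (a j).2).2.2 j hj).mp (ha j hj)
    refine ⟨Equiv.ofBijective d hd, a, fun i => ?_, fun j hj => ?_⟩
    · exact I.encode_entry_pos_iff.mp (hg i i.2).2.1
    · have h := hw j hj
      rw [← ha j hj, ← hda j hj, ← hda _ (Nat.mod_lt _ hK), I.memStrict_iff] at h
      exact h
  · rintro ⟨d, a, hd, hw⟩
    -- Agents in the variables from `10` on, their objects from `10 + K` on; below `10` truncated
    -- subtraction gives the irrelevant value `a 0`.
    let env : ℕ → ℕ := fun x => if x - 10 < K then a (x - 10) else d (a (x - 10 - K))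
    have h1 : ∀ j < K, env (10 + j) = a j := fun j hj => by simp [env, hj]
    have h2 : ∀ j, env (10 + K + j) = d (a j) := fun j => by
      have e1 : 10 + K + j - 10 = K + j := by omega
      have e2 : K + j - K = j := by omega
      simp [env, e1, e2]
    refine ⟨env, fun j _ => ?_, fun j hj => ?_, fun i => if h : i < I.n then d ⟨i, h⟩ else 0,
      fun i hi => ?_, fun i hi j hj h => ?_⟩
    · dsimp only [env]
      split_ifs <;> exact Fin.is_lt _
    · rw [h1 j hj, h2, h2, I.memStrict_iff]
      exact hw j hj
    · simp only [dif_pos hi]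
      refine ⟨Fin.is_lt _, I.encode_entry_pos_iff (i := ⟨i, hi⟩).mpr (hd _), fun j hj => ?_⟩
      rw [h1 j hj, h2, Fin.val_inj, d.injective.eq_iff, Fin.ext_iff]
    · simp only [dif_pos (Set.mem_Iio.mp hi), dif_pos (Set.mem_Iio.mp hj), Fin.val_inj,
        d.injective.eq_iff, Fin.mk.injEq] at h
      exact h

theorem decidableInPolyTime_robustExPostEfficient (k : ℕ) :
    DecidableInPolyTime
      (fun I : {I : AssignmentInstance // I.pref.numTypes ≤ k} => I.1.encode)
      (fun I => RobustExPostEfficient I.1.pref I.1.realMatrix) := by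
  refine decidableInPolyTime_of_loopStmt (LoopStmt.robustnessTest k.factorial)
    (.load LoopExpr.resultAddr) (fun I => I.1.size_le_inputSize) (fun I h => ?_) (fun I h => ?_)
  · simp only [LoopExpr.eval, LoopExpr.eval_resultAddr]
    refine (LoopStmt.exec_robustnessTest _ _ _ _).2 fun h' => ?_
    exact (I.1.exists_memClosedWalk_iff I.2).mp h' h
  · simp only [LoopExpr.eval, LoopExpr.eval_resultAddr]
    exact (LoopStmt.exec_robustnessTest _ _ _ _).1 ((I.1.exists_memClosedWalk_iff I.2).mpr h)

theorem theorem11 (k : ℕ) :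
    -- polynomial-time decidability on the instances with at most `k` agent types
    DecidableInPolyTime
      (fun I : {I : AssignmentInstance // I.pref.numTypes ≤ k} => I.1.encode)
      (fun I => RobustExPostEfficient I.1.pref I.1.realMatrix) ∧
    -- the test through short trading cycles is correct
    (∀ (n : ℕ) (pref : Profile n) (p : Matrix (Fin n) (Fin n) ℝ),
      p ∈ doublyStochastic ℝ (Fin n) →
      (RobustExPostEfficient pref p ↔
        ¬ ∃ c : TradingCycle pref p, c.Short ∧ c.RestMatchable)) ∧
    -- the number of short trading cycles is `O(n ^ (2 * k))`
    (∃ C : ℕ, ∀ (n : ℕ) (pref : Profile n) (p : Matrix (Fin n) (Fin n) ℝ),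
      p ∈ doublyStochastic ℝ (Fin n) → pref.numTypes ≤ k →
      {c : TradingCycle pref p | c.Short}.encard ≤ ((C * n ^ (2 * k) : ℕ) : ℕ∞)) :=
  ⟨decidableInPolyTime_robustExPostEfficient k, fun _ _ _ hp => robustExPostEfficient_iff hp,
    k, fun _ _ _ _ h => TradingCycle.encard_short_le h⟩
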